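/- **Setting.** Let $B$ be a Bayesian network (BN) on binary variables $X_1,\dots,X_n$, numbered so that every parent precedes its children, with conditional probability tables $\mu_{v,a}=P(X_v=1\mid X_{\mathrm{pa}(v)}=a)\in[0,1]$. Let $D(x)=\prod_v P(x_v\mid x_{\mathrm{pa}(v)})$ be its distribution on $\{0,1\}^n$, put $\sigma_{v,a}=\sqrt{\mu_{v,a}(1-\mu_{v,a})}$, and for $S\subseteq[n]$ let $$\phi_S(x)=\prod_{v\in S}\frac{x_v-\mu_{v,x_{\mathrm{pa}(v)}}}{\sigma_{v,x_{\mathrm{pa}(v)}}},\qquad \hat f_S=\mathbb E_{X\sim D}[f(X)\phi_S(X)]$$ (a factor with $\sigma=0$ is read as $0$). Let $f:\{0,1\}^n\to\mathbb R$ be a Boolean function with values in $\{0,1\}$ or $\{-1,1\}$, or more generally any function with $|f|\le 1$. **The extended KM algorithm** with threshold $\theta$ and sample sizes $m_1,m_2$ calls $\mathrm{Coef}(\text{empty string},0)$. For $\alpha\in\{0,1\}^k$, identified with a subset of the last $k$ indices, $\mathrm{Coef}(\alpha,k)$ draws $m_1$ independent samples as follows: $u=(X_1,\dots,X_{n-k})$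 is drawn by forward sampling in the BN, and then two completions $Y_1,Y_2$ of $u$ are drawn by forward sampling, independently given $u$. Let $G_\alpha$ be the mean of the $m_1$ values $f(uY_1)f(uY_2)\phi_\alpha(uY_1)\phi_\alpha(uY_2)$. If $G_\alpha<\theta^2/2$, it returns $\emptyset$; otherwise it returns $\{\alpha\}$ if $k=n$, and $\mathrm{Coef}(0\alpha,k+1)\cup\mathrm{Coef}(1\alpha,k+1)$ if $k<n$. For every returned set $S$ the coefficient is then estimated by the mean $\tilde f_S$ of $f(X)\phi_S(X)$ over $m_2$ fresh forward samples $X\sim D$. **Theorem.** There are sample sizes $m_1,m_2$, depending only on $n,\theta,\gamma,\delta$ and bounded by a polynomial in $n,1/\theta,1/\gamma,1/\delta$, such that for all $n$, $B$, $f$ as above and all $\theta,\gamma,\delta>0$ the extended KM algorithm returns, with probability at least $1-\delta$, a list $\mathcal A$ of distinct sets with estimates $\tilde f_S$ ($S\in\mathcal A$), and so the hypothesis $h(x)=\sum_{S\in\mathcal A}\tilde f_S\,\phi_S(x)$, such that 1. $\mathcal A$ contains every $S\subseteq[n]$ with $|\hat f_S|\ge\theta$; 2. $|\mathcal A|\le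 4/\theta^2$; 3. $|\tilde f_S-\hat f_S|\le\gamma$ for all $S\in\mathcal A$. Moreover, the algorithm runs in time polynomial in $n,1/\theta,1/\gamma,1/\delta$: there is one fixed program for a randomized real RAM (unit-cost real arithmetic, square roots and comparisons, coin tosses of given bias, look-ups in the conditional probability tables of $B$, and a membership query (MQ) oracle for $f$) which, given $n,\theta,\gamma,\delta$, halts on all outcomes of its coin tosses within polynomially many steps in $n,1/\theta,1/\gamma,1/\delta$; which executes the extended KM algorithm except that it may abort without a result (each list is returned with at most the probability with which the extended KM algorithm returns it); and which returns a list with properties 1–3 with probability at least $1-\delta$. -/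

import Mathlib

noncomputable section

/-! ### Bayesian networks and the induced Fourier basis -/

/-- The Boolean cube `{0,1}^n`. -/
abbrev Cube (n : ℕ) := Fin n → Bool

/-- A Bayesian network on the binary variables `X_0, …, X_{n-1}`, numbered along a topological order
of the directed acyclic graph (every parent precedes its children). `cpt v a` is the conditional
probability table entry `P(X_v = 1 | X_{pa(v)} = a)`. -/
structure BayesNet (n : ℕ) where
  parents : Fin n → Finset (Fin n)
  parents_lt : ∀ v, ∀ u ∈ parents v, u < v
  cpt : (v : Fin n) → ({u // u ∈ parents v} → Bool) → ℝ
  cpt_nonneg : ∀ v a, 0 ≤ cpt v a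
  cpt_le_one : ∀ v a, cpt v a ≤ 1

namespace BayesNet

variable {n : ℕ}

/-- `μ_{v, x_{pa(v)}}`: the conditional mean of `X_v` given that its parents take their values in
`x`. -/
def mean (B : BayesNet n) (v : Fin n) (x : Cube n) : ℝ := B.cpt v (fun u => x u.1)

/-- `σ_{v, x_{pa(v)}}`: the conditional standard deviation of the binary variable `X_v`. -/
def sd (B : BayesNet n) (v : Fin n) (x : Cube n) : ℝ :=
  Real.sqrt (B.mean v x * (1 - B.mean v x))

/-- The joint distribution `D(x) = ∏_v P(x_v | x_{pa(v)})`. -/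
def prob (B : BayesNet n) (x : Cube n) : ℝ :=
  ∏ v, if x v then B.mean v x else 1 - B.mean v x

/-- Expectation under `D`. -/
def expect (B : BayesNet n) (g : Cube n → ℝ) : ℝ := ∑ x, B.prob x * g x

/-- `φ_S(x) = ∏_{v ∈ S} (x_v - μ_{v, x_{pa(v)}}) / σ_{v, x_{pa(v)}}`. A factor with `σ = 0` is read
as `0`; where all the table entries lie strictly between `0` and `1` this does not occur. -/
def basis (B : BayesNet n) (S : Finset (Fin n)) (x : Cube n) : ℝ :=
  ∏ v ∈ S, ((if x v then 1 else 0) - B.mean v x) / B.sd v x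

/-- The Fourier coefficient `E_D[f φ_S]`. -/
def coeff (B : BayesNet n) (f : Cube n → ℝ) (S : Finset (Fin n)) : ℝ :=
  B.expect (fun x => f x * B.basis S x)

end BayesNet

/-! ### The extended KM algorithm as a random procedure -/

/-- A coin with success probability `p` (truncated to `[0,1]`). -/
def coin (p : ℝ) : PMF Bool :=
  PMF.ofFintype (fun b => if b then min (ENNReal.ofReal p) 1 else 1 - min (ENNReal.ofReal p) 1)
    (by simp)

namespace BayesNet

variable {n : ℕ}

/-- Forward sampling: the variables in the list are drawn one after the other from their
conditional probability tables, the remaining ones keep their values. -/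
def forward (B : BayesNet n) : List (Fin n) → Cube n → PMF (Cube n)
  | [], x => PMF.pure x
  | v :: vs, x => (coin (B.mean v x)).bind fun b => B.forward vs (Function.update x v b)

/-- A draw of the first `m` variables (the others are set to `0`). -/
def samplePrefix (B : BayesNet n) (m : ℕ) : PMF (Cube n) :=
  B.forward ((List.finRange n).take m) (fun _ => false)

/-- A draw of the variables after the first `m`, conditionally on the first `m` being as in `u`. -/
def sampleSuffix (B : BayesNet n) (m : ℕ) (u : Cube n) : PMF (Cube n) :=
  B.forward ((List.finRange n).drop m) u

end BayesNet

/-- The sum of `m` independent draws from `ν`. -/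
def iidSum (ν : PMF ℝ) : ℕ → PMF ℝ
  | 0 => PMF.pure 0
  | m + 1 => (iidSum ν m).bind fun s => ν.map fun z => s + z

/-- The empirical mean of `m` independent draws from `ν`. -/
def empiricalMean (ν : PMF ℝ) (m : ℕ) : PMF ℝ := (iidSum ν m).map fun s => s / m

namespace BayesNet

variable {n : ℕ}

/-- One draw of `f(uY₁) f(uY₂) φ(uY₁) φ(uY₂)`, where `u` consists of the first `m` variables, `Y₁` and
`Y₂` are conditionally independent completions of `u`, and `φ` is the basis function of the string
`α` of length `n - m`, given as the set `S ⊆ {m, …, n-1}`. -/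
def pairSample (B : BayesNet n) (f : Cube n → ℝ) (m : ℕ) (S : Finset (Fin n)) : PMF ℝ :=
  (B.samplePrefix m).bind fun u =>
    (B.sampleSuffix m u).bind fun x =>
      (B.sampleSuffix m u).map fun y => f x * f y * B.basis S x * B.basis S y

/-- One draw of `f(X) φ_S(X)`. -/
def coeffSample (B : BayesNet n) (f : Cube n → ℝ) (S : Finset (Fin n)) : PMF ℝ :=
  (B.samplePrefix n).map fun x => f x * B.basis S x

/-- The recursive search `Coef(α, k)` with `k = n - m`. The string `α` is given as the set
`S ⊆ {m, …, n-1}`; the recursive calls are `Coef(0α, k+1)` and `Coef(1α, k+1)`. The estimate `G_α` uses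
`m₁` samples. -/
def search (B : BayesNet n) (f : Cube n → ℝ) (θ : ℝ) (m₁ : ℕ) :
    (m : ℕ) → m ≤ n → Finset (Fin n) → PMF (List (Finset (Fin n)))
  | 0, _, S =>
    (empiricalMean (B.pairSample f 0 S) m₁).bind fun G =>
      if θ ^ 2 / 2 ≤ G then PMF.pure [S] else PMF.pure []
  | m + 1, h, S =>
    (empiricalMean (B.pairSample f (m + 1) S) m₁).bind fun G =>
      if θ ^ 2 / 2 ≤ G then
        (B.search f θ m₁ m (Nat.le_of_succ_le h) S).bind fun l₀ =>
          (B.search f θ m₁ m (Nat.le_of_succ_le h) (insert ⟨m, h⟩ S)).map fun l₁ => l₀ ++ l₁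
      else PMF.pure []

/-- Attaches to every set of the list an estimate of its coefficient from `m₂` fresh samples. -/
def estimate (B : BayesNet n) (f : Cube n → ℝ) (m₂ : ℕ) :
    List (Finset (Fin n)) → PMF (List (Finset (Fin n) × ℝ))
  | [] => PMF.pure []
  | S :: l =>
    (empiricalMean (B.coeffSample f S) m₂).bind fun c =>
      (B.estimate f m₂ l).map fun r => (S, c) :: r

/-- The extended KM algorithm with `m₁` samples for each `G_α` and `m₂` samples for each
coefficient: the law of the list of sets with their estimated coefficients. -/
def extendedKM (B : BayesNet n) (f : Cube n → ℝ) (θ : ℝ) (m₁ m₂ : ℕ) :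
    PMF (List (Finset (Fin n) × ℝ)) :=
  (B.search f θ m₁ n le_rfl ∅).bind fun l => B.estimate f m₂ l

/-- The guarantee on the returned list of sets `S ∈ A` with estimates `c_S`, and on the hypothesis
`h(x) = ∑_{S ∈ A} c_S φ_S(x)` that it represents. -/
structure IsGoodOutput (B : BayesNet n) (f : Cube n → ℝ) (θ γ : ℝ)
    (l : List (Finset (Fin n) × ℝ)) (h : Cube n → ℝ) : Prop where
  nodup : (l.map Prod.fst).Nodup
  heavy : ∀ S, θ ≤ |B.coeff f S| → S ∈ l.map Prod.fst
  length_le : (l.length : ℝ) ≤ 4 / θ ^ 2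
  accurate : ∀ p ∈ l, |p.2 - B.coeff f p.1| ≤ γ
  hyp_eq : ∀ x, h x = (l.map fun p => p.2 * B.basis p.1 x).sum

end BayesNet

/-! ### Randomized real RAM programs with oracles -/

/-- The memory: integer and real variables, and two-dimensional integer and real arrays. -/
structure RamState where
  nat : ℕ → ℕ
  real : ℕ → ℝ
  natArr : ℕ → ℕ → ℕ → ℕ
  realArr : ℕ → ℕ → ℕ → ℝ

/-- Integer expressions (no multiplication). -/
inductive NatExpr
  | const (k : ℕ)
  | var (x : ℕ)
  | arr (a : ℕ) (i j : NatExpr)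
  | add (e₁ e₂ : NatExpr)
  | sub (e₁ e₂ : NatExpr)

def NatExpr.eval (s : RamState) : NatExpr → ℕ
  | const k => k
  | var x => s.nat x
  | arr a i j => s.natArr a (i.eval s) (j.eval s)
  | add e₁ e₂ => e₁.eval s + e₂.eval s
  | sub e₁ e₂ => e₁.eval s - e₂.eval s

/-- The number of operations in the evaluation of an expression. -/
def NatExpr.cost : NatExpr → ℕ
  | const _ => 1
  | var _ => 1
  | arr _ i j => i.cost + j.cost + 1
  | add e₁ e₂ => e₁.cost + e₂.cost + 1
  | sub e₁ e₂ => e₁.cost + e₂.cost + 1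

/-- Real expressions: exact arithmetic and square roots, no rounding (`x / 0 = 0`, `√x = 0` for
`x < 0`). -/
inductive RealExpr
  | ofNat (e : NatExpr)
  | var (x : ℕ)
  | arr (a : ℕ) (i j : NatExpr)
  | add (e₁ e₂ : RealExpr)
  | sub (e₁ e₂ : RealExpr)
  | mul (e₁ e₂ : RealExpr)
  | div (e₁ e₂ : RealExpr)
  | sqrt (e : RealExpr)

def RealExpr.eval (s : RamState) : RealExpr → ℝ
  | ofNat e => (e.eval s : ℝ)
  | var x => s.real x
  | arr a i j => s.realArr a (i.eval s) (j.eval s)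
  | add e₁ e₂ => e₁.eval s + e₂.eval s
  | sub e₁ e₂ => e₁.eval s - e₂.eval s
  | mul e₁ e₂ => e₁.eval s * e₂.eval s
  | div e₁ e₂ => e₁.eval s / e₂.eval s
  | sqrt e => Real.sqrt (e.eval s)

def RealExpr.cost : RealExpr → ℕ
  | ofNat e => e.cost + 1
  | var _ => 1
  | arr _ i j => i.cost + j.cost + 1
  | add e₁ e₂ => e₁.cost + e₂.cost + 1
  | sub e₁ e₂ => e₁.cost + e₂.cost + 1
  | mul e₁ e₂ => e₁.cost + e₂.cost + 1
  | div e₁ e₂ => e₁.cost + e₂.cost + 1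
  | sqrt e => e.cost + 1

/-- Tests. -/
inductive TestExpr
  | natLt (e₁ e₂ : NatExpr)
  | natEq (e₁ e₂ : NatExpr)
  | realLe (e₁ e₂ : RealExpr)

def TestExpr.Holds (s : RamState) : TestExpr → Prop
  | natLt e₁ e₂ => e₁.eval s < e₂.eval s
  | natEq e₁ e₂ => e₁.eval s = e₂.eval s
  | realLe e₁ e₂ => e₁.eval s ≤ e₂.eval s

def TestExpr.cost : TestExpr → ℕ
  | natLt e₁ e₂ => e₁.cost + e₂.cost + 1
  | natEq e₁ e₂ => e₁.cost + e₂.cost + 1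
  | realLe e₁ e₂ => e₁.cost + e₂.cost + 1

/-- Elementary instructions. `flip x p` tosses a coin of bias `p` and stores the result in the
integer variable `x`. `query x a i` asks the membership oracle for the value of the target function
at the point stored in row `i` of the integer array `a`. `lookup x v a i` reads from the
conditional probability table of the node `v` the entry selected by that point. -/
inductive Instr
  | skip
  | setNat (x : ℕ) (e : NatExpr)
  | setReal (x : ℕ) (e : RealExpr)
  | setNatArr (a : ℕ) (i j e : NatExpr)
  | setRealArr (a : ℕ) (i j : NatExpr) (e : RealExpr)
  | flip (x : ℕ) (p : RealExpr)
  | query (x : ℕ) (a : ℕ) (i : NatExpr)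
  | lookup (x : ℕ) (v : NatExpr) (a : ℕ) (i : NatExpr)

namespace RamState

def setNat (s : RamState) (x k : ℕ) : RamState :=
  { s with nat := Function.update s.nat x k }

def setReal (s : RamState) (x : ℕ) (r : ℝ) : RamState :=
  { s with real := Function.update s.real x r }

def setNatArr (s : RamState) (a i j k : ℕ) : RamState :=
  { s with natArr := fun a' i' j' => if a' = a ∧ i' = i ∧ j' = j then k else s.natArr a' i' j' }

def setRealArr (s : RamState) (a i j : ℕ) (r : ℝ) : RamState :=
  { s with realArr := fun a' i' j' => if a' = a ∧ i' = i ∧ j' = j then r else s.realArr a' i' j' }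

/-- The point of the cube stored in row `i` of the integer array `a` (nonzero entries mean `1`). -/
def point (n : ℕ) (s : RamState) (a i : ℕ) : Cube n := fun j => decide (s.natArr a i j ≠ 0)

/-- The memory at the start: the inputs `n` and `θ, γ, δ` are in variables, all else is `0`. -/
def init (n : ℕ) (θ γ δ : ℝ) : RamState where
  nat := fun x => if x = 0 then n else 0
  real := fun x => if x = 0 then θ else if x = 1 then γ else if x = 2 then δ else 0
  natArr := fun _ _ _ => 0
  realArr := fun _ _ _ => 0

/-- The output read off at the end of a run. Variable `1` is `0` if the run was aborted without a
result. Otherwise variable `2` holds the length of the returned list; the `j`-th set is in row `j`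
of the integer array `0`, and its estimated coefficient in entry `(j, 0)` of the real array `0`. -/
def output (n : ℕ) (s : RamState) : Option (List (Finset (Fin n) × ℝ)) :=
  if s.nat 1 = 0 then none
  else some ((List.range (s.nat 2)).map fun j =>
    (Finset.univ.filter fun i => s.point n 0 j i = true, s.realArr 0 j 0))

end RamState

/-- The effect of an elementary instruction, with the tables of `B` and the target function `f` as
oracles. -/
def Instr.run {n : ℕ} (B : BayesNet n) (f : Cube n → ℝ) (s : RamState) : Instr → PMF RamState
  | skip => PMF.pure s
  | setNat x e => PMF.pure (s.setNat x (e.eval s))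
  | setReal x e => PMF.pure (s.setReal x (e.eval s))
  | setNatArr a i j e => PMF.pure (s.setNatArr a (i.eval s) (j.eval s) (e.eval s))
  | setRealArr a i j e => PMF.pure (s.setRealArr a (i.eval s) (j.eval s) (e.eval s))
  | flip x p => (coin (p.eval s)).map fun b => s.setNat x (if b then 1 else 0)
  | query x a i => PMF.pure (s.setReal x (f (s.point n a (i.eval s))))
  | lookup x v a i => PMF.pure (s.setReal x
      (if h : v.eval s < n then B.mean ⟨v.eval s, h⟩ (s.point n a (i.eval s)) else 0))

/-- The number of steps of an elementary instruction; the two oracle calls are charged for reading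
a point of the cube. -/
def Instr.cost (n : ℕ) : Instr → ℕ
  | skip => 1
  | setNat _ e => e.cost + 1
  | setReal _ e => e.cost + 1
  | setNatArr _ i j e => i.cost + j.cost + e.cost + 1
  | setRealArr _ i j e => i.cost + j.cost + e.cost + 1
  | flip _ p => p.cost + 1
  | query _ _ i => i.cost + n + 1
  | lookup _ v _ i => v.cost + i.cost + n + 1

/-- Programs. -/
inductive Program
  | instr (i : Instr)
  | seq (P Q : Program)
  | ite (b : TestExpr) (P Q : Program)
  | loop (b : TestExpr) (P : Program)

/-- `Exec B f P s μ`: started in the memory `s`, the program `P` halts on all outcomes of its coin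
tosses, and `μ` is the joint law of the final memory and of the number of steps. `loop b P` repeats
`P` as long as `b` holds. -/
inductive Exec {n : ℕ} (B : BayesNet n) (f : Cube n → ℝ) :
    Program → RamState → PMF (RamState × ℕ) → Prop
  | instr (i : Instr) (s : RamState) :
      Exec B f (.instr i) s ((i.run B f s).map fun s' => (s', i.cost n))
  | seq {P Q : Program} {s : RamState} {μ : PMF (RamState × ℕ)}
      {ν : RamState × ℕ → PMF (RamState × ℕ)} (hP : Exec B f P s μ)
      (hQ : ∀ r ∈ μ.support, Exec B f Q r.1 (ν r)) :
      Exec B f (.seq P Q) s (μ.bind fun r => (ν r).map fun q => (q.1, r.2 + q.2))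
  | ite_true {b : TestExpr} {P Q : Program} {s : RamState} {μ : PMF (RamState × ℕ)}
      (hb : b.Holds s) (hP : Exec B f P s μ) :
      Exec B f (.ite b P Q) s (μ.map fun r => (r.1, b.cost + r.2))
  | ite_false {b : TestExpr} {P Q : Program} {s : RamState} {μ : PMF (RamState × ℕ)}
      (hb : ¬ b.Holds s) (hQ : Exec B f Q s μ) :
      Exec B f (.ite b P Q) s (μ.map fun r => (r.1, b.cost + r.2))
  | loop_stop {b : TestExpr} {P : Program} {s : RamState} (hb : ¬ b.Holds s) :
      Exec B f (.loop b P) s (PMF.pure (s, b.cost))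
  | loop_step {b : TestExpr} {P : Program} {s : RamState} {μ : PMF (RamState × ℕ)}
      {ν : RamState × ℕ → PMF (RamState × ℕ)} (hb : b.Holds s) (hP : Exec B f P s μ)
      (hL : ∀ r ∈ μ.support, Exec B f (.loop b P) r.1 (ν r)) :
      Exec B f (.loop b P) s (μ.bind fun r => (ν r).map fun q => (q.1, b.cost + r.2 + q.2))

end

/-! For a node $(m,S)$ of the search tree, $S\subseteq\{m,\dots,n-1\}$, let $W(m,S)=\mathbb
E_u\big[\mathbb E[f\phi_S\mid u]^2\big]$, where $u$ consists of the first $m$ variables (`weight`).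
Conditionally on the past, the factor of $\phi$ at a node $v$ has mean $0$ and variance $1$, or
vanishes if $\sigma=0$. For a bit of mean $p$ one has $\mathbb E[g^2]=(\mathbb E
g)^2+p(1-p)(g_1-g_0)^2$, and this is exactly $W(m+1,S)=W(m,S)+W(m,S\cup\{m\})$ (`weight_succ`). So
weight is additive down the tree, the leaves carry $\hat f_S^2$ (`weight_zero`) and the root carries
$\mathbb E f^2\le1$ (`weight_root_le`).

Two completions of the same $u$ are conditionally independent, so the samples behind $G_\alpha$ have
mean $W(m,S)$ (`pairSample_mean`). The functions $\phi_S$ are not bounded uniformly in the tables,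
but $\mathbb E[\phi_S^2\mid u]\le1$ (`sampleSuffix_ev_basis_sq_le`), hence all samples have second
moment at most $1$ and Chebyshev's inequality gives sample sizes that do not depend on $B$.

Suppose every estimate is off by less than $\theta^2/4$. Accepted nodes then have weight at least
$\theta^2/4$ and rejected ones less than $\theta^2$. By additivity no ancestor of a heavy set is
rejected, at most $4/\theta^2$ leaves are accepted, and at most $1+8n/\theta^2$ calls are made
(`callBound_le`). A union bound along this adaptive tree (`search_failure_le`) and one over the list
found (`estimate_failure_le`) each cost $\delta/2$.

Inaccurate estimates could make the recursion exponentially long. The machine therefore runs it with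
an explicit stack and gives up after a fixed number of calls (`boundedKM`). Giving up only lowers
the probability of each list (`boundedKM_le_extendedKM`), so success is proved for `boundedKM` and
inherited by the unbounded algorithm.

That the program realizes `boundedKM` is shown in a relational logic: `Simulates` couples an
execution with a draw from an abstract law, and rules for sequence, branch and loop compose
couplings and add up costs (`extendedKM_simulates`). -/

noncomputable section

/-! ### Auxiliary facts on probability mass functions -/

namespace PMF

variable {α β : Type*}

theorem bind_congr_support {p : PMF α} {q q' : α → PMF β} (h : ∀ a ∈ p.support, q a = q' a) :
    p.bind q = p.bind q' := by
  ext b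
  rw [bind_apply, bind_apply]
  refine tsum_congr fun a => ?_
  by_cases ha : a ∈ p.support
  · rw [h a ha]
  · rw [(p.apply_eq_zero_iff a).2 ha, zero_mul, zero_mul]

theorem map_congr_support {p : PMF α} {g g' : α → β} (h : ∀ a ∈ p.support, g a = g' a) :
    p.map g = p.map g' :=
  bind_congr_support fun a ha => by simp [h a ha]

end PMF

/-! ### Determinism and frame conditions of executions -/

section Exec

variable {n : ℕ} {B : BayesNet n} {f : Cube n → ℝ}

/-- The law of the result of an execution is determined by the program and the initial memory. -/
theorem Exec.unique {P : Program} {s : RamState} {μ μ' : PMF (RamState × ℕ)}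
    (h : Exec B f P s μ) (h' : Exec B f P s μ') : μ = μ' := by
  induction h generalizing μ' with
  | instr i s => cases h'; rfl
  | seq hP hQ ihP ihQ =>
    cases h' with
    | seq hP' hQ' =>
      cases ihP hP'
      exact PMF.bind_congr_support fun r hr => by rw [ihQ r hr (hQ' r hr)]
  | ite_true hb hP ih =>
    cases h' with
    | ite_true hb' hP' => rw [ih hP']
    | ite_false hb' hP' => exact absurd hb hb'
  | ite_false hb hP ih =>
    cases h' with
    | ite_true hb' hP' => exact absurd hb' hb
    | ite_false hb' hP' => rw [ih hP']
  | loop_stop hb =>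
    cases h' with
    | loop_stop _ => rfl
    | loop_step hb' _ _ => exact absurd hb' hb
  | loop_step hb hP hL ihP ihL =>
    cases h' with
    | loop_stop hb' => exact absurd hb hb'
    | loop_step _ hP' hL' =>
      cases ihP hP'
      exact PMF.bind_congr_support fun r hr => by rw [ihL r hr (hL' r hr)]

/-- The integer variables that an instruction may write. -/
def Instr.writesNat : Instr → ℕ → Bool
  | setNat x _, y => y == x
  | flip x _, y => y == x
  | _, _ => false

/-- The real variables that an instruction may write. -/
def Instr.writesReal : Instr → ℕ → Bool
  | setReal x _, y => y == x
  | query x _ _, y => y == x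
  | lookup x _ _ _, y => y == x
  | _, _ => false

/-- The integer arrays that an instruction may write. -/
def Instr.writesNatArr : Instr → ℕ → Bool
  | setNatArr a _ _ _, y => y == a
  | _, _ => false

/-- The real arrays that an instruction may write. -/
def Instr.writesRealArr : Instr → ℕ → Bool
  | setRealArr a _ _ _, y => y == a
  | _, _ => false

/-- Whether some instruction of the program has the property `w`. -/
def Program.any (w : Instr → Bool) : Program → Bool
  | instr i => w i
  | seq P Q => P.any w || Q.any w
  | ite _ P Q => P.any w || Q.any w
  | loop _ P => P.any w

/-- The memory `s'` differs from `s` only in variables and arrays that `P` may write. -/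
structure Frame (P : Program) (s s' : RamState) : Prop where
  nat : ∀ x, P.any (·.writesNat x) = false → s'.nat x = s.nat x
  real : ∀ x, P.any (·.writesReal x) = false → s'.real x = s.real x
  natArr : ∀ a, P.any (·.writesNatArr a) = false → s'.natArr a = s.natArr a
  realArr : ∀ a, P.any (·.writesRealArr a) = false → s'.realArr a = s.realArr a

namespace Frame

variable {P Q : Program} {s s' s'' : RamState}

theorem refl (P : Program) (s : RamState) : Frame P s s :=
  ⟨fun _ _ => rfl, fun _ _ => rfl, fun _ _ => rfl, fun _ _ => rfl⟩

theorem trans (h : Frame P s s') (h' : Frame P s' s'') : Frame P s s'' :=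
  ⟨fun x hx => (h'.nat x hx).trans (h.nat x hx), fun x hx => (h'.real x hx).trans (h.real x hx),
    fun x hx => (h'.natArr x hx).trans (h.natArr x hx),
    fun x hx => (h'.realArr x hx).trans (h.realArr x hx)⟩

/-- Lets the frame of a part count as a frame of the whole: an instruction kind absent from the
whole is absent from the part. -/
theorem of_any_le (h : Frame P s s') (hPQ : ∀ w, Q.any w = false → P.any w = false) :
    Frame Q s s' :=
  ⟨fun x hx => h.nat x (hPQ _ hx), fun x hx => h.real x (hPQ _ hx),
    fun x hx => h.natArr x (hPQ _ hx), fun x hx => h.realArr x (hPQ _ hx)⟩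

theorem of_instr {i : Instr} (h : s' ∈ (i.run B f s).support) : Frame (.instr i) s s' := by
  cases i with
  | flip x p =>
    simp only [Instr.run, PMF.support_map, Set.mem_image] at h
    obtain ⟨b, -, rfl⟩ := h
    refine ⟨fun y hy => ?_, fun _ _ => rfl, fun _ _ => rfl, fun _ _ => rfl⟩
    exact Function.update_of_ne (by simpa [Program.any, Instr.writesNat] using hy) _ _
  | skip => simp only [Instr.run, PMF.mem_support_pure_iff] at h; subst h; exact refl _ _
  | setNat x e =>
    simp only [Instr.run, PMF.mem_support_pure_iff] at h
    subst h
    refine ⟨fun y hy => ?_, fun _ _ => rfl, fun _ _ => rfl, fun _ _ => rfl⟩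
    exact Function.update_of_ne (by simpa [Program.any, Instr.writesNat] using hy) _ _
  | setNatArr a i j e =>
    simp only [Instr.run, PMF.mem_support_pure_iff] at h
    subst h
    refine ⟨fun _ _ => rfl, fun _ _ => rfl, fun y hy => ?_, fun _ _ => rfl⟩
    have : y ≠ a := by simpa [Program.any, Instr.writesNatArr] using hy
    funext i' j'
    simp [RamState.setNatArr, this]
  | setRealArr a i j e =>
    simp only [Instr.run, PMF.mem_support_pure_iff] at h
    subst h
    refine ⟨fun _ _ => rfl, fun _ _ => rfl, fun _ _ => rfl, fun y hy => ?_⟩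
    have : y ≠ a := by simpa [Program.any, Instr.writesRealArr] using hy
    funext i' j'
    simp [RamState.setRealArr, this]
  | setReal x e | query x a i | lookup x v a i =>
    simp only [Instr.run, PMF.mem_support_pure_iff] at h
    subst h
    refine ⟨fun _ _ => rfl, fun y hy => ?_, fun _ _ => rfl, fun _ _ => rfl⟩
    exact Function.update_of_ne (by simpa [Program.any, Instr.writesReal] using hy) _ _

end Frame

/-- Memory that a program has no instruction to write survives every run. For concrete programs the
syntactic test is settled by evaluation, so loop invariants need only mention what actually changes.
-/
theorem Exec.frame {P : Program} {s : RamState} {μ : PMF (RamState × ℕ)} (h : Exec B f P s μ) :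
    ∀ r ∈ μ.support, Frame P s r.1 := by
  induction h with
  | instr i s =>
    intro r hr
    simp only [PMF.support_map, Set.mem_image] at hr
    obtain ⟨s', hs', rfl⟩ := hr
    exact Frame.of_instr hs'
  | seq hP hQ ihP ihQ =>
    intro r hr
    simp only [PMF.mem_support_bind_iff, PMF.support_map, Set.mem_image] at hr
    obtain ⟨r₁, h₁, r₂, h₂, rfl⟩ := hr
    exact Frame.trans ((ihP r₁ h₁).of_any_le fun w hw => (Bool.or_eq_false_iff.1 hw).1)
      ((ihQ r₁ h₁ r₂ h₂).of_any_le fun w hw => (Bool.or_eq_false_iff.1 hw).2)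
  | ite_true hb hP ih =>
    intro r hr
    simp only [PMF.support_map, Set.mem_image] at hr
    obtain ⟨r', hr', rfl⟩ := hr
    exact (ih r' hr').of_any_le fun w hw => (Bool.or_eq_false_iff.1 hw).1
  | ite_false hb hP ih =>
    intro r hr
    simp only [PMF.support_map, Set.mem_image] at hr
    obtain ⟨r', hr', rfl⟩ := hr
    exact (ih r' hr').of_any_le fun w hw => (Bool.or_eq_false_iff.1 hw).2
  | loop_stop hb =>
    intro r hr
    rw [PMF.mem_support_pure_iff] at hr
    subst hr
    exact Frame.refl _ _
  | loop_step hb hP hL ihP ihL =>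
    intro r hr
    simp only [PMF.mem_support_bind_iff, PMF.support_map, Set.mem_image] at hr
    obtain ⟨r₁, h₁, r₂, h₂, rfl⟩ := hr
    exact Frame.trans ((ihP r₁ h₁).of_any_le fun w hw => hw) (ihL r₁ h₁ r₂ h₂)

end Exec

/-! ### A relational program logic -/

/-- Started in the memory `s`, the program `P` halts within `T` steps on all outcomes, and its result
can be coupled with a draw `a` from `ν` such that the final memory `s'` satisfies `R a s'`. -/
def Simulates {n : ℕ} (B : BayesNet n) (f : Cube n → ℝ) {A : Type} (P : Program) (s : RamState)
    (ν : PMF A) (T : ℕ) (R : A → RamState → Prop) : Prop :=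
  ∃ κ : PMF (A × (RamState × ℕ)), Exec B f P s (κ.map Prod.snd) ∧ κ.map Prod.fst = ν ∧
    ∀ p ∈ κ.support, R p.1 p.2.1 ∧ p.2.2 ≤ T

/-- The law of `k` random steps, numbered from `i` on. -/
def iterSteps {A : Type} (step : ℕ → A → PMF A) : ℕ → ℕ → A → PMF A
  | _, 0, a => PMF.pure a
  | i, k + 1, a => (step i a).bind (iterSteps step (i + 1) k)

/-- `iterSteps` unfolds at the first step, whereas `iidSum` adds its draws at the last one; this
turns one into the other. -/
theorem iterSteps_succ_right {A : Type} (step : ℕ → A → PMF A) (i k : ℕ) (a : A) :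
    iterSteps step i (k + 1) a = (iterSteps step i k a).bind (step (i + k)) := by
  induction k generalizing i a with
  | zero => simp [iterSteps, PMF.bind_pure]
  | succ k ih =>
    rw [iterSteps, iterSteps, PMF.bind_bind]
    congr 1
    funext a'
    rw [ih]
    congr 2
    omega

theorem iterSteps_pure {A : Type} (i k : ℕ) (a : A) :
    iterSteps (fun _ => PMF.pure) i k a = PMF.pure a := by
  induction k generalizing i with
  | zero => rfl
  | succ k ih => rw [iterSteps, PMF.pure_bind, ih]

namespace Simulates

variable {n : ℕ} {B : BayesNet n} {f : Cube n → ℝ} {A A' : Type} {P Q : Program} {s : RamState}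
  {ν : PMF A} {T T' : ℕ} {R : A → RamState → Prop}

/-- The second marginal of the coupling is the law of an execution, so `Exec.frame` applies to each
coupled outcome. -/
theorem frame (h : Simulates B f P s ν T R) :
    Simulates B f P s ν T fun a s' => R a s' ∧ Frame P s s' := by
  obtain ⟨κ, hκ, hν, hR⟩ := h
  refine ⟨κ, hκ, hν, fun p hp => ⟨⟨(hR p hp).1, hκ.frame p.2 ?_⟩, (hR p hp).2⟩⟩
  rw [PMF.support_map]
  exact ⟨p, hp, rfl⟩

theorem map (h : Simulates B f P s ν T R) (g : A → A') {R' : A' → RamState → Prop}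
    (hR : ∀ a s', R a s' → Frame P s s' → R' (g a) s') :
    Simulates B f P s (ν.map g) T R' := by
  obtain ⟨κ, hκ, hν, hR'⟩ := h.frame
  refine ⟨κ.map fun p => (g p.1, p.2), ?_, ?_, ?_⟩
  · rw [PMF.map_comp]; exact hκ
  · rw [PMF.map_comp, ← hν, PMF.map_comp]; rfl
  · intro p hp
    rw [PMF.support_map] at hp
    obtain ⟨q, hq, rfl⟩ := hp
    exact ⟨hR _ _ (hR' q hq).1.1 (hR' q hq).1.2, (hR' q hq).2⟩

theorem mono (h : Simulates B f P s ν T R) {R' : A → RamState → Prop}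
    (hR : ∀ a s', R a s' → Frame P s s' → R' a s') : Simulates B f P s ν T R' := by
  simpa [PMF.map_id] using h.map id hR

theorem of_le (h : Simulates B f P s ν T R) (hT : T ≤ T') : Simulates B f P s ν T' R := by
  obtain ⟨κ, hκ, hν, hR⟩ := h
  exact ⟨κ, hκ, hν, fun p hp => ⟨(hR p hp).1, (hR p hp).2.trans hT⟩⟩

theorem law_eq (h : Simulates B f P s ν T R) {ν' : PMF A} (hν : ν = ν') :
    Simulates B f P s ν' T R := hν ▸ h

theorem instr {i : Instr} {s' : RamState} {a : A} (hi : i.run B f s = PMF.pure s') (hR : R a s') :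
    Simulates B f (.instr i) s (PMF.pure a) (i.cost n) R := by
  refine ⟨PMF.pure (a, (s', i.cost n)), ?_, ?_, ?_⟩
  · have := Exec.instr (B := B) (f := f) i s
    rw [PMF.pure_map]
    rwa [hi, PMF.pure_map] at this
  · rw [PMF.pure_map]
  · intro p hp
    rw [PMF.mem_support_pure_iff] at hp
    subst hp
    exact ⟨hR, le_rfl⟩

theorem instr_setNat {x : ℕ} {e : NatExpr} {a : A} (hR : R a (s.setNat x (e.eval s))) :
    Simulates B f (.instr (.setNat x e)) s (PMF.pure a) (e.cost + 1) R := instr rfl hR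

theorem instr_setReal {x : ℕ} {e : RealExpr} {a : A} (hR : R a (s.setReal x (e.eval s))) :
    Simulates B f (.instr (.setReal x e)) s (PMF.pure a) (e.cost + 1) R := instr rfl hR

theorem flip (x : ℕ) (p : RealExpr) :
    Simulates B f (.instr (.flip x p)) s (coin (p.eval s)) (p.cost + 1)
      fun b s' => s' = s.setNat x (if b then 1 else 0) := by
  refine ⟨(coin (p.eval s)).map fun b => (b, (s.setNat x (if b then 1 else 0), p.cost + 1)),
    ?_, ?_, ?_⟩
  · have := Exec.instr (B := B) (f := f) (.flip x p) s
    rw [PMF.map_comp]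
    rwa [Instr.run, PMF.map_comp] at this
  · rw [PMF.map_comp]; exact PMF.map_id _
  · intro q hq
    rw [PMF.support_map] at hq
    obtain ⟨b, -, rfl⟩ := hq
    exact ⟨rfl, le_rfl⟩

/-- Couplings of the outcomes of a random first part with outcomes of the rest can be composed. -/
theorem exists_coupling_bind {κ : PMF (A × (RamState × ℕ))} {ν' : A → PMF A'}
    {R' : A' → RamState → Prop} {c : ℕ} (hT : ∀ p ∈ κ.support, p.2.2 ≤ T)
    (h : ∀ p ∈ κ.support, Simulates B f Q p.2.1 (ν' p.1) T' R') :
    ∃ (ρ : RamState × ℕ → PMF (RamState × ℕ)) (κ' : PMF (A' × (RamState × ℕ))),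
      (∀ r ∈ (κ.map Prod.snd).support, Exec B f Q r.1 (ρ r)) ∧
      κ'.map Prod.snd = ((κ.map Prod.snd).bind fun r => (ρ r).map fun q => (q.1, c + r.2 + q.2)) ∧
      κ'.map Prod.fst = (κ.map Prod.fst).bind ν' ∧
      ∀ p ∈ κ'.support, R' p.1 p.2.1 ∧ p.2.2 ≤ c + T + T' := by
  classical
  have : Nonempty (PMF (A' × (RamState × ℕ))) := by
    obtain ⟨p, hp⟩ := κ.support_nonempty
    exact ⟨(h p hp).choose⟩
  choose! K hK₁ hK₂ hK₃ using h
  -- The law of the rest must be a function of the memory and step count `r` alone, while the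
  -- hypothesis supplies one for each coupled pair `p` over `r`. Any choice will do, because
  -- executions are unique.
  have hex : ∀ r, ∃ μ, r ∈ (κ.map Prod.snd).support → Exec B f Q r.1 μ := by
    intro r
    by_cases hr : r ∈ (κ.map Prod.snd).support
    · rw [PMF.support_map] at hr
      obtain ⟨p, hp, rfl⟩ := hr
      exact ⟨_, fun _ => hK₁ p hp⟩
    · exact ⟨PMF.pure r, fun h => absurd h hr⟩
  choose ρ hρ using hex
  refine ⟨ρ, κ.bind fun p => (K p).map fun q => (q.1, (q.2.1, c + p.2.2 + q.2.2)), hρ, ?_, ?_, ?_⟩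
  · rw [PMF.map_bind, PMF.bind_map]
    refine PMF.bind_congr_support fun p hp => ?_
    have : ρ p.2 = (K p).map Prod.snd :=
      (hρ p.2 (by rw [PMF.support_map]; exact ⟨p, hp, rfl⟩)).unique (hK₁ p hp)
    rw [Function.comp_apply, this, PMF.map_comp, PMF.map_comp]
    rfl
  · rw [PMF.map_bind, PMF.bind_map]
    refine PMF.bind_congr_support fun p hp => ?_
    rw [Function.comp_apply, ← hK₂ p hp, PMF.map_comp]
    rfl
  · intro p' hp'
    simp only [PMF.mem_support_bind_iff, PMF.support_map, Set.mem_image] at hp'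
    obtain ⟨p, hp, q, hq, rfl⟩ := hp'
    have h₁ := hK₃ p hp q hq
    exact ⟨h₁.1, Nat.add_le_add (Nat.add_le_add_left (hT p hp) _) h₁.2⟩

theorem seq {ν' : A → PMF A'} {R' : A' → RamState → Prop} (hP : Simulates B f P s ν T R)
    (hQ : ∀ a s', R a s' → Frame P s s' → Simulates B f Q s' (ν' a) T' R') :
    Simulates B f (.seq P Q) s (ν.bind ν') (T + T') R' := by
  obtain ⟨κ, hκ, rfl, hR⟩ := hP.frame
  obtain ⟨ρ, κ', h₁, h₂, h₃, h₄⟩ := exists_coupling_bind (c := 0) (fun p hp => (hR p hp).2)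
    fun p hp => hQ p.1 p.2.1 (hR p hp).1.1 (hR p hp).1.2
  refine ⟨κ', ?_, h₃, by simpa using h₄⟩
  rw [h₂]
  simpa using Exec.seq hκ h₁

/-- Sequential composition after a deterministic part. -/
theorem seq_pure {a : A} {ν' : PMF A'} {R' : A' → RamState → Prop}
    (hP : Simulates B f P s (PMF.pure a) T R)
    (hQ : ∀ s', R a s' → Frame P s s' → Simulates B f Q s' ν' T' R') :
    Simulates B f (.seq P Q) s ν' (T + T') R' := by
  refine (seq (ν := PMF.pure a) (R := fun b s' => b = a ∧ R a s') (ν' := fun _ => ν') ?_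
    fun b s' h hF => hQ s' h.2 hF).law_eq (PMF.bind_const _ _)
  obtain ⟨κ, hκ, hν, hR⟩ := hP
  refine ⟨κ, hκ, hν, fun p hp => ?_⟩
  -- The abstract marginal is a point mass at `a`, so every coupled value is `a`.
  have : p.1 ∈ (κ.map Prod.fst).support := by rw [PMF.support_map]; exact ⟨p, hp, rfl⟩
  rw [hν, PMF.mem_support_pure_iff] at this
  exact ⟨⟨this, this ▸ (hR p hp).1⟩, (hR p hp).2⟩

/-- Execution of a deterministic instruction before the rest of a program. -/
theorem step {i : Instr} {s' : RamState} (hi : i.run B f s = PMF.pure s')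
    (hQ : Simulates B f Q s' ν T R) :
    Simulates B f (.seq (.instr i) Q) s ν (i.cost n + T) R :=
  seq_pure (R := fun (_ : Unit) t => t = s') (a := ()) (instr hi rfl) fun _ h _ => h ▸ hQ

theorem step_setNat {x : ℕ} {e : NatExpr}
    (hQ : Simulates B f Q (s.setNat x (e.eval s)) ν T R) :
    Simulates B f (.seq (.instr (.setNat x e)) Q) s ν (e.cost + 1 + T) R := step rfl hQ

theorem step_setReal {x : ℕ} {e : RealExpr}
    (hQ : Simulates B f Q (s.setReal x (e.eval s)) ν T R) :
    Simulates B f (.seq (.instr (.setReal x e)) Q) s ν (e.cost + 1 + T) R := step rfl hQ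

theorem step_setNatArr {a : ℕ} {i j e : NatExpr}
    (hQ : Simulates B f Q (s.setNatArr a (i.eval s) (j.eval s) (e.eval s)) ν T R) :
    Simulates B f (.seq (.instr (.setNatArr a i j e)) Q) s ν
      (i.cost + j.cost + e.cost + 1 + T) R := step rfl hQ

theorem step_setRealArr {a : ℕ} {i j : NatExpr} {e : RealExpr}
    (hQ : Simulates B f Q (s.setRealArr a (i.eval s) (j.eval s) (e.eval s)) ν T R) :
    Simulates B f (.seq (.instr (.setRealArr a i j e)) Q) s ν
      (i.cost + j.cost + e.cost + 1 + T) R := step rfl hQ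

theorem step_query {x a : ℕ} {i : NatExpr}
    (hQ : Simulates B f Q (s.setReal x (f (s.point n a (i.eval s)))) ν T R) :
    Simulates B f (.seq (.instr (.query x a i)) Q) s ν (i.cost + n + 1 + T) R := step rfl hQ

theorem step_lookup {x a : ℕ} {v i : NatExpr}
    (hQ : Simulates B f Q (s.setReal x (if h : v.eval s < n then
      B.mean ⟨v.eval s, h⟩ (s.point n a (i.eval s)) else 0)) ν T R) :
    Simulates B f (.seq (.instr (.lookup x v a i)) Q) s ν (v.cost + i.cost + n + 1 + T) R :=
  step rfl hQ

theorem ite_true {b : TestExpr} (hb : b.Holds s) (h : Simulates B f P s ν T R) :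
    Simulates B f (.ite b P Q) s ν (b.cost + T) R := by
  obtain ⟨κ, hκ, hν, hR⟩ := h
  refine ⟨κ.map fun p => (p.1, (p.2.1, b.cost + p.2.2)), ?_, ?_, ?_⟩
  · have := Exec.ite_true (Q := Q) hb hκ
    rw [PMF.map_comp] at this ⊢
    exact this
  · rw [PMF.map_comp]; exact hν
  · intro p hp
    rw [PMF.support_map] at hp
    obtain ⟨q, hq, rfl⟩ := hp
    exact ⟨(hR q hq).1, Nat.add_le_add_left (hR q hq).2 _⟩

theorem ite_false {b : TestExpr} (hb : ¬ b.Holds s) (h : Simulates B f Q s ν T R) :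
    Simulates B f (.ite b P Q) s ν (b.cost + T) R := by
  obtain ⟨κ, hκ, hν, hR⟩ := h
  refine ⟨κ.map fun p => (p.1, (p.2.1, b.cost + p.2.2)), ?_, ?_, ?_⟩
  · have := Exec.ite_false (P := P) hb hκ
    rw [PMF.map_comp] at this ⊢
    exact this
  · rw [PMF.map_comp]; exact hν
  · intro p hp
    rw [PMF.support_map] at hp
    obtain ⟨q, hq, rfl⟩ := hp
    exact ⟨(hR q hq).1, Nat.add_le_add_left (hR q hq).2 _⟩

/-- A loop that is passed exactly `N` times. -/
theorem loop {b : TestExpr} {Inv : ℕ → A → RamState → Prop} {step : ℕ → A → PMF A} {N : ℕ} {a : A}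
    (hinit : Inv 0 a s)
    (hstep : ∀ i a s', i < N → Inv i a s' → Frame P s s' →
      b.Holds s' ∧ Simulates B f P s' (step i a) T (Inv (i + 1)))
    (hexit : ∀ a s', Inv N a s' → Frame P s s' → ¬ b.Holds s') :
    Simulates B f (.loop b P) s (iterSteps step 0 N a) (N * (b.cost + T) + b.cost) (Inv N) := by
  -- Induction on the number `k` of passes still to come. The frame is kept relative to the memory
  -- at the start of the loop, and the summand `b.cost` pays for the final failing test.
  suffices H : ∀ k i a s', i + k = N → Inv i a s' → Frame P s s' →
      Simulates B f (.loop b P) s' (iterSteps step i k a) (k * (b.cost + T) + b.cost) (Inv N) from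
    H N 0 a s (by omega) hinit (Frame.refl _ _)
  intro k
  induction k with
  | zero =>
    intro i a s' hi hInv hF
    obtain rfl : i = N := by omega
    refine ⟨PMF.pure (a, (s', b.cost)), ?_, ?_, ?_⟩
    · rw [PMF.pure_map]; exact Exec.loop_stop (hexit a s' hInv hF)
    · rw [PMF.pure_map]; rfl
    · intro p hp
      rw [PMF.mem_support_pure_iff] at hp
      subst hp
      exact ⟨hInv, by simp⟩
  | succ k ih =>
    intro i a s' hi hInv hF
    obtain ⟨hb, hP⟩ := hstep i a s' (by omega) hInv hF
    obtain ⟨κ, hκ, hν, hR⟩ := hP.frame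
    obtain ⟨ρ, κ', h₁, h₂, h₃, h₄⟩ := exists_coupling_bind (c := b.cost)
      (fun p hp => (hR p hp).2)
      fun p hp => ih (i + 1) p.1 p.2.1 (by omega) (hR p hp).1.1 (hF.trans (hR p hp).1.2)
    refine ⟨κ', ?_, ?_, fun p hp => ⟨(h₄ p hp).1, (h₄ p hp).2.trans (by rw [Nat.succ_mul]; omega)⟩⟩
    · rw [h₂]; exact Exec.loop_step hb hκ h₁
    · rw [h₃, hν]; rfl

/-- A deterministic loop that is passed exactly `N` times. -/
theorem loop_pure {b : TestExpr} {Inv : ℕ → RamState → Prop} {N : ℕ} (hinit : Inv 0 s)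
    (hstep : ∀ i s', i < N → Inv i s' → Frame P s s' →
      b.Holds s' ∧ Simulates B f P s' (PMF.pure ()) T fun _ => Inv (i + 1))
    (hexit : ∀ s', Inv N s' → Frame P s s' → ¬ b.Holds s') :
    Simulates B f (.loop b P) s (PMF.pure ()) (N * (b.cost + T) + b.cost) fun _ => Inv N :=
  (loop (Inv := fun i _ => Inv i) (step := fun _ => PMF.pure) hinit (fun i _ s' => hstep i s')
    fun _ s' => hexit s').law_eq (iterSteps_pure _ _ _)

end Simulates
end

noncomputable section

/-! ### Expectations of finitely supported laws -/

namespace PMF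

variable {α β : Type*}

/-- The expectation of a real function; it is used for finitely supported laws only. -/
def ev (p : PMF α) (g : α → ℝ) : ℝ := ∑' a, (p a).toReal * g a

theorem ev_eq_sum {p : PMF α} (hp : p.support.Finite) (g : α → ℝ) :
    p.ev g = ∑ a ∈ hp.toFinset, (p a).toReal * g a := by
  refine tsum_eq_sum fun a ha => ?_
  rw [(p.apply_eq_zero_iff a).2 (by simpa using ha)]
  simp

theorem ev_eq_sum_fintype [Fintype α] (p : PMF α) (g : α → ℝ) :
    p.ev g = ∑ a, (p a).toReal * g a := tsum_fintype _

theorem summable_ev {p : PMF α} (hp : p.support.Finite) (g : α → ℝ) :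
    Summable fun a => (p a).toReal * g a := by
  refine summable_of_ne_finset_zero (s := hp.toFinset) fun a ha => ?_
  rw [(p.apply_eq_zero_iff a).2 (by simpa using ha)]
  simp

theorem ev_congr {p : PMF α} {g g' : α → ℝ} (h : ∀ a ∈ p.support, g a = g' a) :
    p.ev g = p.ev g' := by
  refine tsum_congr fun a => ?_
  by_cases ha : a ∈ p.support
  · rw [h a ha]
  · simp [(p.apply_eq_zero_iff a).2 ha]

theorem ev_mono {p : PMF α} (hp : p.support.Finite) {g g' : α → ℝ}
    (h : ∀ a ∈ p.support, g a ≤ g' a) : p.ev g ≤ p.ev g' := by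
  rw [ev_eq_sum hp, ev_eq_sum hp]
  exact Finset.sum_le_sum fun a ha =>
    mul_le_mul_of_nonneg_left (h a (by simpa using ha)) ENNReal.toReal_nonneg

theorem ev_nonneg (p : PMF α) {g : α → ℝ} (h : ∀ a, 0 ≤ g a) : 0 ≤ p.ev g :=
  tsum_nonneg fun a => mul_nonneg ENNReal.toReal_nonneg (h a)

theorem ev_add {p : PMF α} (hp : p.support.Finite) (g g' : α → ℝ) :
    p.ev (fun a => g a + g' a) = p.ev g + p.ev g' := by
  simp only [ev_eq_sum hp, mul_add, Finset.sum_add_distrib]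

theorem ev_const_mul (p : PMF α) (c : ℝ) (g : α → ℝ) :
    p.ev (fun a => c * g a) = c * p.ev g := by
  simp only [ev, ← tsum_mul_left]
  exact tsum_congr fun a => by ring

theorem ev_mul_const (p : PMF α) (c : ℝ) (g : α → ℝ) :
    p.ev (fun a => g a * c) = p.ev g * c := by
  simp only [mul_comm _ c, ev_const_mul]

theorem ev_const (p : PMF α) (c : ℝ) : p.ev (fun _ => c) = c := by
  have h : ∑' a, (p a).toReal = 1 := by
    rw [← ENNReal.tsum_toReal_eq (fun a => p.apply_ne_top a), p.tsum_coe, ENNReal.toReal_one]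
  simp only [ev, tsum_mul_right, h, one_mul]

theorem ev_le_of_le {p : PMF α} (hp : p.support.Finite) {g : α → ℝ} {c : ℝ}
    (h : ∀ a ∈ p.support, g a ≤ c) : p.ev g ≤ c :=
  (ev_mono hp h).trans_eq (ev_const p c)

theorem ev_pure (a : α) (g : α → ℝ) : (PMF.pure a).ev g = g a := by
  rw [ev, tsum_eq_single a fun b hb => by simp [PMF.pure_apply, hb]]
  simp

/-- The tower property. Finite support reduces the outer sum to a finite one, which may be exchanged
with the series. -/
theorem ev_bind {p : PMF α} {q : α → PMF β} (hp : p.support.Finite)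
    (hq : ∀ a ∈ p.support, (q a).support.Finite) (g : β → ℝ) :
    (p.bind q).ev g = p.ev fun a => (q a).ev g := by
  have h : ∀ b, ((p.bind q) b).toReal * g b =
      ∑ a ∈ hp.toFinset, (p a).toReal * ((q a b).toReal * g b) := by
    intro b
    rw [bind_apply, tsum_eq_sum (s := hp.toFinset) fun a ha => by
        rw [(p.apply_eq_zero_iff a).2 (by simpa using ha), zero_mul],
      ENNReal.toReal_sum fun a _ => ENNReal.mul_ne_top (p.apply_ne_top a) ((q a).apply_ne_top b),
      Finset.sum_mul]
    exact Finset.sum_congr rfl fun a _ => by rw [ENNReal.toReal_mul, mul_assoc]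
  rw [ev_eq_sum hp, ev, tsum_congr h, Summable.tsum_finsetSum fun a ha =>
    (summable_ev (hq a (by simpa using ha)) g).mul_left _]
  exact Finset.sum_congr rfl fun a _ => tsum_mul_left

theorem ev_map {p : PMF α} (hp : p.support.Finite) (φ : α → β) (g : β → ℝ) :
    (p.map φ).ev g = p.ev fun a => g (φ a) := by
  rw [PMF.map, ev_bind hp fun a _ => by simp]
  simp [ev_pure]

theorem support_bind_finite {p : PMF α} {q : α → PMF β} (hp : p.support.Finite)
    (hq : ∀ a ∈ p.support, (q a).support.Finite) : (p.bind q).support.Finite := by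
  rw [support_bind]
  exact hp.biUnion hq

theorem support_map_finite {p : PMF α} (hp : p.support.Finite) (φ : α → β) :
    (p.map φ).support.Finite := by
  rw [support_map]
  exact hp.image φ

/-! ### Probabilities of events -/

/-- A failure of the whole is a failure of the first part, or of the second after a successful
first part. -/
theorem toOuterMeasure_bind_le {p : PMF α} {q : α → PMF β} {E : Set β} (F : Set α) {c : ENNReal}
    (h : ∀ a ∉ F, (q a).toOuterMeasure E ≤ c) :
    (p.bind q).toOuterMeasure E ≤ p.toOuterMeasure F + c := by
  classical
  have h1 : ∀ a, (q a).toOuterMeasure E ≤ 1 := fun a => by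
    rw [toOuterMeasure_apply, ← (q a).tsum_coe]
    exact ENNReal.tsum_le_tsum fun b => Set.indicator_le_self _ _ b
  rw [toOuterMeasure_bind_apply, toOuterMeasure_apply]
  calc ∑' a, p a * (q a).toOuterMeasure E ≤ ∑' a, (F.indicator p a + p a * c) := by
        refine ENNReal.tsum_le_tsum fun a => ?_
        by_cases ha : a ∈ F
        · rw [Set.indicator_of_mem ha]
          exact le_add_right ((mul_le_mul_right (h1 a) _).trans_eq (mul_one _))
        · rw [Set.indicator_of_notMem ha, zero_add]
          exact mul_le_mul_right (h a ha) _
    _ = _ := by rw [ENNReal.tsum_add, ENNReal.tsum_mul_right, p.tsum_coe, one_mul]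

theorem ofReal_one_sub_le_toOuterMeasure {p : PMF α} {E : Set α} {δ : ℝ} (hδ : 0 ≤ δ)
    (h : p.toOuterMeasure Eᶜ ≤ ENNReal.ofReal δ) :
    ENNReal.ofReal (1 - δ) ≤ p.toOuterMeasure E := by
  rw [ENNReal.ofReal_sub _ hδ, ENNReal.ofReal_one, tsub_le_iff_right]
  calc (1 : ENNReal) = p.toOuterMeasure (E ∪ Eᶜ) := by
        rw [Set.union_compl_self, (toOuterMeasure_apply_eq_one_iff p _).2 (Set.subset_univ _)]
    _ ≤ p.toOuterMeasure E + p.toOuterMeasure Eᶜ := MeasureTheory.measure_union_le _ _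
    _ ≤ _ := by gcongr

/-- Chebyshev's inequality about an arbitrary centre. -/
theorem toOuterMeasure_le_of_ev_sq {p : PMF ℝ} (hp : p.support.Finite) (c : ℝ) {ε V : ℝ}
    (hε : 0 < ε) (hV : p.ev (fun z => (z - c) ^ 2) ≤ V) :
    p.toOuterMeasure {z | ε ≤ |z - c|} ≤ ENNReal.ofReal (V / ε ^ 2) := by
  classical
  have h : p.toOuterMeasure {z | ε ≤ |z - c|} =
      ENNReal.ofReal (p.ev fun z => if ε ≤ |z - c| then 1 else 0) := by
    rw [toOuterMeasure_apply, ev, ENNReal.ofReal_tsum_of_nonneg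
      (fun a => mul_nonneg ENNReal.toReal_nonneg (by split_ifs <;> norm_num))
      (summable_ev hp _)]
    refine tsum_congr fun a => ?_
    by_cases ha : ε ≤ |a - c|
    · rw [Set.indicator_of_mem (by exact ha), if_pos ha, mul_one,
        ENNReal.ofReal_toReal (p.apply_ne_top a)]
    · rw [Set.indicator_of_notMem (by exact ha), if_neg ha, mul_zero, ENNReal.ofReal_zero]
  rw [h]
  refine ENNReal.ofReal_le_ofReal ?_
  rw [le_div_iff₀ (by positivity), ← ev_mul_const]
  refine (ev_mono hp fun z _ => ?_).trans hV
  split_ifs with hz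
  · rw [one_mul, ← sq_abs (z - c)]
    gcongr
  · rw [zero_mul]; positivity

end PMF

open PMF

/-! ### Empirical means -/

theorem iidSum_support_finite {ν : PMF ℝ} (hν : ν.support.Finite) (m : ℕ) :
    (iidSum ν m).support.Finite := by
  induction m with
  | zero => simp [iidSum]
  | succ m ih => exact support_bind_finite ih fun s _ => support_map_finite hν _

/-- Variances of independent draws add up, and a variance is at most the second moment. -/
theorem iidSum_ev_sq {ν : PMF ℝ} (hν : ν.support.Finite) {c V : ℝ} (hc : ν.ev (fun z => z) = c)
    (hV : ν.ev (fun z => z ^ 2) ≤ V) (m : ℕ) :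
    (iidSum ν m).ev (fun s => (s - m * c) ^ 2) ≤ m * V := by
  induction m with
  | zero => simp [iidSum, ev_pure]
  | succ m ih =>
    rw [iidSum, ev_bind (iidSum_support_finite hν m) fun s _ => support_map_finite hν _]
    -- Averaging over the new draw `z` moves the centre from $(m+1)c$ back to $mc$ and adds the
    -- variance $\mathbb E z^2-c^2$; the cross term is absorbed by completing the square.
    have h : ∀ s, (ν.map fun z => s + z).ev (fun s => (s - ((m + 1 : ℕ) : ℝ) * c) ^ 2) =
        (s - m * c) ^ 2 + (ν.ev (fun z => z ^ 2) - c ^ 2) := by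
      intro s
      rw [ev_map hν]
      have : (fun z => (s + z - ((m + 1 : ℕ) : ℝ) * c) ^ 2) = fun z : ℝ =>
          z ^ 2 + (2 * (s - (m + 1) * c) * z + (s - (m + 1) * c) ^ 2) := by
        funext z; push_cast; ring
      rw [this, ev_add hν, ev_add hν, ev_const_mul, ev_const, hc]
      ring
    simp only [h]
    rw [ev_add (iidSum_support_finite hν m), ev_const]
    push_cast
    nlinarith [sq_nonneg c]

/-- The empirical mean of draws with second moment at most `1` is accurate up to `ε` except with
probability `1 / (m ε²)`. -/
theorem empiricalMean_inaccurate_le {ν : PMF ℝ} (hν : ν.support.Finite) {c : ℝ}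
    (hc : ν.ev (fun z => z) = c) (hV : ν.ev (fun z => z ^ 2) ≤ 1) {m : ℕ} (hm : 0 < m) {ε : ℝ}
    (hε : 0 < ε) :
    (empiricalMean ν m).toOuterMeasure {z | ε ≤ |z - c|} ≤ ENNReal.ofReal (1 / (m * ε ^ 2)) := by
  have hm' : (0 : ℝ) < m := by exact_mod_cast hm
  have h : (empiricalMean ν m).ev (fun z => (z - c) ^ 2) ≤ 1 / m := by
    rw [empiricalMean, ev_map (iidSum_support_finite hν m)]
    have : (fun s : ℝ => (s / m - c) ^ 2) = fun s => (1 / m ^ 2 : ℝ) * (s - m * c) ^ 2 := by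
      funext s; field_simp
    rw [this, ev_const_mul]
    calc (1 / m ^ 2 : ℝ) * _ ≤ (1 / m ^ 2 : ℝ) * (m * 1) := by
          gcongr; exact iidSum_ev_sq hν hc hV m
      _ = 1 / m := by field_simp
  refine (toOuterMeasure_le_of_ev_sq (support_map_finite (iidSum_support_finite hν m) _) c hε
    h).trans_eq ?_
  rw [div_div]

/-! ### Forward sampling -/

theorem coin_true_toReal {p : ℝ} (h0 : 0 ≤ p) (h1 : p ≤ 1) : (coin p true).toReal = p := by
  simp [coin, PMF.ofFintype_apply, h0, h1]

theorem coin_false_toReal {p : ℝ} (h0 : 0 ≤ p) (h1 : p ≤ 1) : (coin p false).toReal = 1 - p := by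
  have : min (ENNReal.ofReal p) 1 = ENNReal.ofReal p := by simp [h1]
  simp only [coin, PMF.ofFintype_apply, Bool.false_eq_true, if_false, this]
  rw [← ENNReal.ofReal_one, ← ENNReal.ofReal_sub _ h0, ENNReal.toReal_ofReal (by linarith)]

theorem coin_ev {p : ℝ} (h0 : 0 ≤ p) (h1 : p ≤ 1) (g : Bool → ℝ) :
    (coin p).ev g = p * g true + (1 - p) * g false := by
  rw [ev_eq_sum_fintype, Fintype.sum_bool, coin_true_toReal h0 h1, coin_false_toReal h0 h1]

namespace BayesNet

variable {n : ℕ} (B : BayesNet n)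

theorem mean_nonneg (v : Fin n) (x : Cube n) : 0 ≤ B.mean v x := B.cpt_nonneg _ _

theorem mean_le_one (v : Fin n) (x : Cube n) : B.mean v x ≤ 1 := B.cpt_le_one _ _

/-- The topological numbering enters here: the table row used at `v` is determined by the earlier
variables. -/
theorem mean_congr {v : Fin n} {x y : Cube n} (h : ∀ u < v, x u = y u) : B.mean v x = B.mean v y :=
  congrArg (B.cpt v) (funext fun u => h u.1 (B.parents_lt v u.1 u.2))

theorem forward_append (l l' : List (Fin n)) (x : Cube n) :
    B.forward (l ++ l') x = (B.forward l x).bind (B.forward l') := by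
  induction l generalizing x with
  | nil => simp [forward, PMF.pure_bind]
  | cons v l ih =>
    rw [List.cons_append, forward, forward, PMF.bind_bind]
    simp only [ih]

theorem eq_of_mem_support_forward {l : List (Fin n)} {x y : Cube n}
    (hy : y ∈ (B.forward l x).support) {v : Fin n} (hv : v ∉ l) : y v = x v := by
  induction l generalizing x with
  | nil =>
    rw [forward, PMF.mem_support_pure_iff] at hy
    rw [hy]
  | cons w l ih =>
    rw [forward, PMF.mem_support_bind_iff] at hy
    obtain ⟨b, -, hb⟩ := hy
    rw [List.mem_cons, not_or] at hv
    rw [ih hb hv.2, Function.update_of_ne hv.1]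

theorem sampleSuffix_of_lt {m : ℕ} (h : m < n) (u : Cube n) :
    B.sampleSuffix m u =
      (coin (B.mean ⟨m, h⟩ u)).bind fun b =>
        B.sampleSuffix (m + 1) (Function.update u ⟨m, h⟩ b) := by
  rw [sampleSuffix, List.drop_eq_getElem_cons (by simpa using h), forward]
  simp [sampleSuffix]

theorem sampleSuffix_self (u : Cube n) : B.sampleSuffix n u = PMF.pure u := by
  rw [sampleSuffix, List.drop_eq_nil_of_le (by simp), forward]

theorem samplePrefix_succ {m : ℕ} (h : m < n) :
    B.samplePrefix (m + 1) =
      (B.samplePrefix m).bind fun u => (coin (B.mean ⟨m, h⟩ u)).map (Function.update u ⟨m, h⟩) := by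
  rw [samplePrefix, List.take_succ_eq_append_getElem (by simpa using h), forward_append]
  simp [samplePrefix, forward, PMF.map]
  rfl

theorem samplePrefix_zero : B.samplePrefix 0 = PMF.pure fun _ => false := by
  rw [samplePrefix, List.take_zero, forward]

theorem samplePrefix_self : B.samplePrefix n = B.sampleSuffix 0 fun _ => false := by
  rw [samplePrefix, sampleSuffix, List.take_of_length_le (by simp), List.drop_zero]

theorem eq_of_mem_support_sampleSuffix {m : ℕ} {u x : Cube n}
    (hx : x ∈ (B.sampleSuffix m u).support) {v : Fin n} (hv : v.1 < m) : x v = u v := by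
  refine B.eq_of_mem_support_forward hx fun hmem => ?_
  obtain ⟨i, hi, h⟩ := List.mem_iff_getElem.1 hmem
  rw [List.getElem_drop, List.getElem_finRange] at h
  rw [← h] at hv
  simp at hv

theorem sampleSuffix_ev_of_lt {m : ℕ} (h : m < n) (u : Cube n) (g : Cube n → ℝ) :
    (B.sampleSuffix m u).ev g =
      B.mean ⟨m, h⟩ u * (B.sampleSuffix (m + 1) (Function.update u ⟨m, h⟩ true)).ev g +
      (1 - B.mean ⟨m, h⟩ u) *
        (B.sampleSuffix (m + 1) (Function.update u ⟨m, h⟩ false)).ev g := by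
  rw [sampleSuffix_of_lt B h, ev_bind (Set.toFinite _) fun _ _ => Set.toFinite _,
    coin_ev (B.mean_nonneg _ _) (B.mean_le_one _ _)]

/-! ### One-step conditioning and the second moments of the basis. -/

/-- One factor of a basis function. -/
def factor (v : Fin n) (x : Cube n) : ℝ := ((if x v then 1 else 0) - B.mean v x) / B.sd v x

theorem basis_eq_prod_factor (S : Finset (Fin n)) (x : Cube n) :
    B.basis S x = ∏ v ∈ S, B.factor v x := rfl

/-- Once $u$ and the bit at $m$ are fixed, the factor at $m$ is a constant and can be pulled out of
the conditional expectation over the later variables. -/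
theorem basis_insert_of_mem_support {m : ℕ} (h : m < n) {S : Finset (Fin n)}
    (hS : ∀ v ∈ S, m + 1 ≤ v.1) {u x : Cube n} {b : Bool}
    (hx : x ∈ (B.sampleSuffix (m + 1) (Function.update u ⟨m, h⟩ b)).support) :
    B.basis (insert ⟨m, h⟩ S) x =
      ((if b then 1 else 0) - B.mean ⟨m, h⟩ u) / B.sd ⟨m, h⟩ u * B.basis S x := by
  have hm : (⟨m, h⟩ : Fin n) ∉ S := fun hmem => by simpa using hS _ hmem
  have hxm : x ⟨m, h⟩ = b := by
    rw [B.eq_of_mem_support_sampleSuffix hx (Nat.lt_succ_self m), Function.update_self]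
  have hmean : B.mean ⟨m, h⟩ x = B.mean ⟨m, h⟩ u := B.mean_congr fun w hw => by
    rw [B.eq_of_mem_support_sampleSuffix hx (Nat.lt_succ_of_lt hw), Function.update_of_ne hw.ne]
  rw [basis_eq_prod_factor, Finset.prod_insert hm, ← basis_eq_prod_factor, factor, sd, sd, hxm,
    hmean]

theorem sd_sq (v : Fin n) (x : Cube n) :
    B.sd v x ^ 2 = B.mean v x * (1 - B.mean v x) :=
  Real.sq_sqrt (mul_nonneg (B.mean_nonneg v x) (sub_nonneg.2 (B.mean_le_one v x)))

/-- Going back from the last variable, each factor contributes a conditional second moment of $1$,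
or of $0$ where $\sigma=0$. With degenerate tables equality fails, but only the upper bound matters.
-/
theorem sampleSuffix_ev_basis_sq_le (m : ℕ) (hm : m ≤ n) (S : Finset (Fin n))
    (hS : ∀ v ∈ S, m ≤ v.1) (u : Cube n) :
    (B.sampleSuffix m u).ev (fun x => B.basis S x ^ 2) ≤ 1 := by
  induction hm using Nat.decreasingInduction generalizing S u with
  | self =>
    rw [sampleSuffix_self, ev_pure]
    have : S = ∅ := Finset.eq_empty_of_forall_notMem fun v hv => absurd v.2 (not_lt.2 (hS v hv))
    simp [this, basis]
  | of_succ m h ih =>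
    have hp0 := B.mean_nonneg ⟨m, h⟩ u
    have hp1 := B.mean_le_one ⟨m, h⟩ u
    rw [sampleSuffix_ev_of_lt B h]
    by_cases hmS : (⟨m, h⟩ : Fin n) ∈ S
    · have hS' : ∀ v ∈ S.erase ⟨m, h⟩, m + 1 ≤ v.1 := fun v hv => by
        have h1 := hS v (Finset.mem_of_mem_erase hv)
        have h2 : v.1 ≠ m := fun h2 => Finset.ne_of_mem_erase hv (Fin.ext h2)
        omega
      have hval : ∀ b, (B.sampleSuffix (m + 1) (Function.update u ⟨m, h⟩ b)).ev
          (fun x => B.basis S x ^ 2) ≤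
            (((if b then 1 else 0) - B.mean ⟨m, h⟩ u) / B.sd ⟨m, h⟩ u) ^ 2 := fun b => by
        rw [ev_congr (g' := fun x =>
          (((if b then 1 else 0) - B.mean ⟨m, h⟩ u) / B.sd ⟨m, h⟩ u) ^ 2 *
            B.basis (S.erase ⟨m, h⟩) x ^ 2) fun x hx => by
          rw [← mul_pow, ← B.basis_insert_of_mem_support h hS' hx, Finset.insert_erase hmS],
          ev_const_mul]
        exact mul_le_of_le_one_right (sq_nonneg _) (ih _ hS' _)
      have h1 := mul_le_mul_of_nonneg_left (hval true) hp0
      have h2 := mul_le_mul_of_nonneg_left (hval false) (sub_nonneg.2 hp1)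
      refine (add_le_add h1 h2).trans ?_
      simp only [if_true, Bool.false_eq_true, if_false, div_pow, sd_sq]
      -- For means $0$ and $1$ the denominator is $0$ and both terms vanish. Otherwise
      -- $p(1-p)^2+(1-p)p^2=p(1-p)$ cancels $\sigma^2$.
      rcases hp0.eq_or_lt with h0 | h0
      · simp [← h0]
      rcases hp1.eq_or_lt with h1 | h1
      · simp [h1]
      · have : 1 - B.mean ⟨m, h⟩ u ≠ 0 := by linarith
        field_simp
        ring_nf
        exact le_rfl
    · have hS' : ∀ v ∈ S, m + 1 ≤ v.1 := fun v hv => by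
        have h1 := hS v hv
        have h2 : v.1 ≠ m := fun h2 => hmS (by rwa [← show v = ⟨m, h⟩ from Fin.ext h2])
        omega
      nlinarith [ih S hS' (Function.update u ⟨m, h⟩ true),
        ih S hS' (Function.update u ⟨m, h⟩ false)]

/-! ### Conditional coefficients and additivity of the weights. -/

/-- The conditional coefficient `E[f φ_S | u]`, where `u` fixes the first `m` variables. -/
def condCoeff (f : Cube n → ℝ) (m : ℕ) (S : Finset (Fin n)) (u : Cube n) : ℝ :=
  (B.sampleSuffix m u).ev fun x => f x * B.basis S x

/-- The total weight of the coefficients of the sets that end in `S`, as the second moment of the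
conditional coefficient. -/
def weight (f : Cube n → ℝ) (m : ℕ) (S : Finset (Fin n)) : ℝ :=
  (B.samplePrefix m).ev fun u => B.condCoeff f m S u ^ 2

variable (f : Cube n → ℝ)

theorem weight_nonneg (m : ℕ) (S : Finset (Fin n)) : 0 ≤ B.weight f m S :=
  ev_nonneg _ fun _ => sq_nonneg _

/-- The coefficient along the factor at $m$ is $\sigma$ times the discrete derivative in that bit.
Written with $p(1-p)/\sigma$ instead of $\sigma$, the formula is what the two branches literally add
up to, and it remains valid for $\sigma=0$. -/
theorem condCoeff_insert {m : ℕ} (h : m < n) {S : Finset (Fin n)} (hS : ∀ v ∈ S, m + 1 ≤ v.1)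
    (u : Cube n) :
    B.condCoeff f m (insert ⟨m, h⟩ S) u =
      B.mean ⟨m, h⟩ u * (1 - B.mean ⟨m, h⟩ u) / B.sd ⟨m, h⟩ u *
        (B.condCoeff f (m + 1) S (Function.update u ⟨m, h⟩ true) -
          B.condCoeff f (m + 1) S (Function.update u ⟨m, h⟩ false)) := by
  have hval : ∀ b, (B.sampleSuffix (m + 1) (Function.update u ⟨m, h⟩ b)).ev
      (fun x => f x * B.basis (insert ⟨m, h⟩ S) x) =
        ((if b then 1 else 0) - B.mean ⟨m, h⟩ u) / B.sd ⟨m, h⟩ u *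
          B.condCoeff f (m + 1) S (Function.update u ⟨m, h⟩ b) := fun b => by
    rw [condCoeff, ← ev_const_mul]
    exact ev_congr fun x hx => by rw [B.basis_insert_of_mem_support h hS hx]; ring
  rw [condCoeff, sampleSuffix_ev_of_lt B h, hval, hval]
  simp only [if_true, Bool.false_eq_true, if_false]
  ring

/-- Parseval's identity for a single bit: the second moment over bit $m$ is the squared mean,
belonging to $S$, plus the variance $p(1-p)(g_1-g_0)^2$, belonging to $S\cup\{m\}$. -/
theorem weight_succ {m : ℕ} (h : m < n) {S : Finset (Fin n)} (hS : ∀ v ∈ S, m + 1 ≤ v.1) :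
    B.weight f (m + 1) S = B.weight f m S + B.weight f m (insert ⟨m, h⟩ S) := by
  rw [weight, samplePrefix_succ B h, ev_bind (Set.toFinite _) fun _ _ => Set.toFinite _, weight,
    weight, ← ev_add (Set.toFinite _)]
  refine congrArg _ (funext fun u => ?_)
  rw [ev_map (Set.toFinite _), coin_ev (B.mean_nonneg _ _) (B.mean_le_one _ _),
    condCoeff_insert B f h hS, condCoeff, condCoeff, condCoeff, sampleSuffix_ev_of_lt B h u]
  -- The identity $a\cdot a/a=a$ holds for $a=0$ as well, so degenerate table entries need no
  -- separate case.
  have hσ : (B.mean ⟨m, h⟩ u * (1 - B.mean ⟨m, h⟩ u) / B.sd ⟨m, h⟩ u) ^ 2 =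
      B.mean ⟨m, h⟩ u * (1 - B.mean ⟨m, h⟩ u) := by
    rw [div_pow, sd_sq, sq, mul_self_div_self]
  rw [mul_pow, hσ]
  ring

/-- The probability of one coordinate given the preceding ones. -/
def localProb (v : Fin n) (x : Cube n) : ℝ := if x v then B.mean v x else 1 - B.mean v x

theorem sampleSuffix_apply (m : ℕ) (hm : m ≤ n) (u x : Cube n) (h : ∀ v : Fin n, v.1 < m → x v = u v) :
    (B.sampleSuffix m u x).toReal = ∏ v with m ≤ v.1, B.localProb v x := by
  induction hm using Nat.decreasingInduction generalizing u with
  | self =>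
    have hx : x = u := funext fun v => h v v.2
    have : Finset.univ.filter (fun v : Fin n => n ≤ v.1) = ∅ :=
      Finset.filter_false_of_mem fun v _ => not_le.2 v.2
    rw [sampleSuffix_self, this, hx]
    simp
  | of_succ m hmn ih =>
    have hmean : B.mean ⟨m, hmn⟩ u = B.mean ⟨m, hmn⟩ x := B.mean_congr fun w hw => (h w hw).symm
    have hset : Finset.univ.filter (fun v : Fin n => m ≤ v.1) =
        insert ⟨m, hmn⟩ (Finset.univ.filter fun v : Fin n => m + 1 ≤ v.1) := by
      ext v
      simp only [Finset.mem_filter, Finset.mem_univ, true_and, Finset.mem_insert, Fin.ext_iff]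
      omega
    have hagree : ∀ v : Fin n, v.1 < m + 1 → x v = Function.update u ⟨m, hmn⟩ (x ⟨m, hmn⟩) v := by
      intro v hv
      by_cases hvm : v = ⟨m, hmn⟩
      · rw [hvm, Function.update_self]
      · rw [Function.update_of_ne hvm]
        refine h v ?_
        have : v.1 ≠ m := fun h => hvm (Fin.ext h)
        omega
    -- A draw never revises bit $m$, so only the branch with the right bit can end in `x`, and the
    -- sum over the coin has a single term.
    have hzero : B.sampleSuffix (m + 1) (Function.update u ⟨m, hmn⟩ (!x ⟨m, hmn⟩)) x = 0 := by
      rw [PMF.apply_eq_zero_iff]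
      intro hx
      have := B.eq_of_mem_support_sampleSuffix hx (v := ⟨m, hmn⟩) (Nat.lt_succ_self m)
      rw [Function.update_self] at this
      simp at this
    rw [hset, Finset.prod_insert (by simp), ← ih _ hagree, sampleSuffix_of_lt B hmn,
      PMF.bind_apply, tsum_fintype, Fintype.sum_bool, hmean, localProb]
    cases hxm : x ⟨m, hmn⟩ with
    | true =>
      rw [hxm] at hzero
      rw [show (!true) = false from rfl] at hzero
      rw [hzero, mul_zero, add_zero, ENNReal.toReal_mul,
        coin_true_toReal (B.mean_nonneg _ _) (B.mean_le_one _ _), if_pos rfl]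
    | false =>
      rw [hxm] at hzero
      rw [show (!false) = true from rfl] at hzero
      rw [hzero, mul_zero, zero_add, ENNReal.toReal_mul,
        coin_false_toReal (B.mean_nonneg _ _) (B.mean_le_one _ _), if_neg (by simp)]

/-- Forward sampling of all variables draws from the joint distribution. -/
theorem samplePrefix_self_ev (g : Cube n → ℝ) : (B.samplePrefix n).ev g = B.expect g := by
  rw [ev_eq_sum_fintype, expect]
  refine Finset.sum_congr rfl fun x _ => ?_
  rw [samplePrefix_self, B.sampleSuffix_apply 0 (Nat.zero_le n) _ x fun v hv => absurd hv (by simp)]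
  simp [prob, localProb]

theorem weight_zero (S : Finset (Fin n)) : B.weight f 0 S = B.coeff f S ^ 2 := by
  rw [weight, samplePrefix_zero, ev_pure, condCoeff, ← samplePrefix_self, samplePrefix_self_ev, coeff]

theorem weight_root_le (hf : ∀ x, |f x| ≤ 1) : B.weight f n ∅ ≤ 1 := by
  refine ev_le_of_le (Set.toFinite _) fun u _ => ?_
  rw [condCoeff, sampleSuffix_self, ev_pure]
  simpa [basis] using hf u

theorem _root_.Finset.filter_le_eq_insert {S : Finset (Fin n)} {m : ℕ} {h : m < n}
    (hm : (⟨m, h⟩ : Fin n) ∈ S) :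
    S.filter (fun v => m ≤ v.1) = insert ⟨m, h⟩ (S.filter fun v => m + 1 ≤ v.1) := by
  ext v
  simp only [Finset.mem_filter, Finset.mem_insert]
  constructor
  · rintro ⟨h1, h2⟩
    by_cases h3 : v = ⟨m, h⟩
    · exact Or.inl h3
    · have : v.1 ≠ m := fun h => h3 (Fin.ext h)
      exact Or.inr ⟨h1, by omega⟩
  · rintro (rfl | ⟨h1, h2⟩)
    · exact ⟨hm, le_rfl⟩
    · exact ⟨h1, by omega⟩

theorem _root_.Finset.filter_le_eq_of_notMem {S : Finset (Fin n)} {m : ℕ} {h : m < n}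
    (hm : (⟨m, h⟩ : Fin n) ∉ S) :
    S.filter (fun v => m ≤ v.1) = S.filter fun v => m + 1 ≤ v.1 := by
  refine Finset.filter_congr fun v hv => ⟨fun h2 => ?_, fun h2 => by omega⟩
  have : v.1 ≠ m := fun h' => hm (by rwa [← show v = ⟨m, h⟩ from Fin.ext h'])
  omega

/-- Climbing from a leaf to the root, each step adds the nonnegative weight of a sibling. Hence
every ancestor of a heavy set has weight at least $\theta^2$. -/
theorem coeff_sq_le_weight (S : Finset (Fin n)) (m : ℕ) (hm : m ≤ n) :
    B.coeff f S ^ 2 ≤ B.weight f m (S.filter fun v => m ≤ v.1) := by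
  induction m with
  | zero => simp [weight_zero]
  | succ m ih =>
    refine (ih (by omega)).trans ?_
    have h := B.weight_succ f (m := m) hm (S := S.filter fun v => m + 1 ≤ v.1) (by simp)
    by_cases hmem : (⟨m, hm⟩ : Fin n) ∈ S
    · rw [Finset.filter_le_eq_insert hmem, h]
      linarith [B.weight_nonneg f m (S.filter fun v => m + 1 ≤ v.1)]
    · rw [Finset.filter_le_eq_of_notMem hmem, h]
      linarith [B.weight_nonneg f m (insert ⟨m, hm⟩ (S.filter fun v => m + 1 ≤ v.1))]

/-! ### Moments of the samples -/

theorem pairSample_support_finite (m : ℕ) (S : Finset (Fin n)) :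
    (B.pairSample f m S).support.Finite :=
  support_bind_finite (Set.toFinite _) fun _ _ => support_bind_finite (Set.toFinite _) fun _ _ =>
    support_map_finite (Set.toFinite _) _

theorem pairSample_ev (m : ℕ) (S : Finset (Fin n)) (g : ℝ → ℝ) :
    (B.pairSample f m S).ev g = (B.samplePrefix m).ev fun u => (B.sampleSuffix m u).ev fun x =>
      (B.sampleSuffix m u).ev fun y => g (f x * f y * B.basis S x * B.basis S y) := by
  have fin : ∀ p : PMF (Cube n), p.support.Finite := fun p => Set.toFinite _
  rw [pairSample, ev_bind (fin _) fun _ _ => support_bind_finite (fin _) fun _ _ =>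
    support_map_finite (fin _) _]
  refine congrArg _ (funext fun u => ?_)
  rw [ev_bind (fin _) fun _ _ => support_map_finite (fin _) _]
  exact congrArg _ (funext fun x => ev_map (fin _) _ _)

/-- Given $u$ the two completions are independent copies, so the expected product is the square of
the conditional coefficient; this is the purpose of drawing two of them. -/
theorem pairSample_mean (m : ℕ) (S : Finset (Fin n)) :
    (B.pairSample f m S).ev (fun z => z) = B.weight f m S := by
  rw [pairSample_ev, weight]
  refine congrArg _ (funext fun u => ?_)
  have : ∀ x y : Cube n, f x * f y * B.basis S x * B.basis S y =
      f x * B.basis S x * (f y * B.basis S y) := fun x y => by ring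
  simp only [this, ev_const_mul, ev_mul_const, condCoeff]
  ring

/-- After $f^2\le1$ is dropped, the second moment given $u$ factors into two copies of $\mathbb
E[\phi_S^2\mid u]\le1$. -/
theorem pairSample_sq_le (hf : ∀ x, |f x| ≤ 1) {m : ℕ} (hm : m ≤ n) {S : Finset (Fin n)}
    (hS : ∀ v ∈ S, m ≤ v.1) : (B.pairSample f m S).ev (fun z => z ^ 2) ≤ 1 := by
  have hf' : ∀ x, f x ^ 2 ≤ 1 := fun x => (sq_le_one_iff_abs_le_one _).2 (hf x)
  rw [pairSample_ev]
  refine ev_le_of_le (Set.toFinite _) fun u _ => ?_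
  have h := B.sampleSuffix_ev_basis_sq_le m hm S hS u
  calc (B.sampleSuffix m u).ev (fun x => (B.sampleSuffix m u).ev fun y =>
          (f x * f y * B.basis S x * B.basis S y) ^ 2)
      ≤ (B.sampleSuffix m u).ev (fun x => (B.sampleSuffix m u).ev fun y =>
          B.basis S x ^ 2 * B.basis S y ^ 2) := by
        refine ev_mono (Set.toFinite _) fun x _ => ev_mono (Set.toFinite _) fun y _ => ?_
        have : (f x * f y * B.basis S x * B.basis S y) ^ 2 =
          (f x ^ 2 * f y ^ 2) * (B.basis S x ^ 2 * B.basis S y ^ 2) := by ring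
        rw [this]
        exact mul_le_of_le_one_left (by positivity)
          (mul_le_one₀ (hf' x) (sq_nonneg _) (hf' y))
    _ = (B.sampleSuffix m u).ev (fun x => B.basis S x ^ 2) *
          (B.sampleSuffix m u).ev (fun x => B.basis S x ^ 2) := by
        simp only [ev_const_mul, ev_mul_const]
    _ ≤ 1 := mul_le_one₀ h (ev_nonneg _ fun _ => sq_nonneg _) h

theorem coeffSample_support_finite (S : Finset (Fin n)) :
    (B.coeffSample f S).support.Finite := support_map_finite (Set.toFinite _) _

theorem coeffSample_mean (S : Finset (Fin n)) :
    (B.coeffSample f S).ev (fun z => z) = B.coeff f S := by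
  rw [coeffSample, ev_map (Set.toFinite _), samplePrefix_self_ev, coeff]

theorem coeffSample_sq_le (hf : ∀ x, |f x| ≤ 1) (S : Finset (Fin n)) :
    (B.coeffSample f S).ev (fun z => z ^ 2) ≤ 1 := by
  rw [coeffSample, ev_map (Set.toFinite _), samplePrefix_self]
  refine le_trans (ev_mono (Set.toFinite _) fun x _ => ?_)
    (B.sampleSuffix_ev_basis_sq_le 0 (Nat.zero_le n) S (fun _ _ => Nat.zero_le _) fun _ => false)
  rw [mul_pow]
  exact mul_le_of_le_one_left (sq_nonneg _) ((sq_le_one_iff_abs_le_one _).2 (hf x))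

end BayesNet
end

noncomputable section

open PMF

/-! ### The search with an explicit stack and a bounded number of calls -/

namespace BayesNet

variable {n : ℕ}

/-- The set `S` together with the index `m`. -/
def addIndex (m : ℕ) (S : Finset (Fin n)) : Finset (Fin n) :=
  if h : m < n then insert ⟨m, h⟩ S else S

theorem addIndex_of_lt {m : ℕ} (h : m < n) (S : Finset (Fin n)) :
    addIndex m S = insert ⟨m, h⟩ S := dif_pos h

/-- The stack of pending calls and the list of sets found so far, after the call for `(m, S)` has been
accepted. -/
def expand (m : ℕ) (S : Finset (Fin n)) (rest : List (ℕ × Finset (Fin n)))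
    (acc : List (Finset (Fin n))) : List (ℕ × Finset (Fin n)) × List (Finset (Fin n)) :=
  match m with
  | 0 => (rest, acc ++ [S])
  | m + 1 => ((m, S) :: (m, addIndex m S) :: rest, acc)

/-- One call of the search: the top of the stack is processed. -/
def stackStep (B : BayesNet n) (f : Cube n → ℝ) (θ : ℝ) (m₁ : ℕ) :
    List (ℕ × Finset (Fin n)) × List (Finset (Fin n)) →
      PMF (List (ℕ × Finset (Fin n)) × List (Finset (Fin n)))
  | ([], acc) => PMF.pure ([], acc)
  | ((m, S) :: rest, acc) => (empiricalMean (B.pairSample f m S) m₁).map fun G =>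
      if θ ^ 2 / 2 ≤ G then expand m S rest acc else (rest, acc)

/-- The law of the extended KM algorithm that is aborted if it needs more than `K` calls. -/
def boundedKM (B : BayesNet n) (f : Cube n → ℝ) (θ : ℝ) (m₁ m₂ K : ℕ) :
    PMF (Option (List (Finset (Fin n) × ℝ))) :=
  (iterSteps (fun _ => B.stackStep f θ m₁) 0 K ([(n, ∅)], [])).bind fun x =>
    if x.1 = [] then (B.estimate f m₂ x.2).map some else PMF.pure none

/-- All pending calls of the search are carried out, without a bound on their number. -/
def searchStack (B : BayesNet n) (f : Cube n → ℝ) (θ : ℝ) (m₁ : ℕ) :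
    List (ℕ × Finset (Fin n)) → List (Finset (Fin n)) → PMF (List (Finset (Fin n)))
  | [], acc => PMF.pure acc
  | (m, S) :: rest, acc =>
    (if h : m ≤ n then B.search f θ m₁ m h S else PMF.pure []).bind fun l =>
      B.searchStack f θ m₁ rest (acc ++ l)

/-! ### Comparison of the stack search with the recursion. -/

variable (B : BayesNet n) (f : Cube n → ℝ) {θ : ℝ} {m₁ : ℕ}

/-- The stack visits the calls in the depth-first order of the recursion, so performing one step
before all the remaining calls leaves the final law unchanged. -/
theorem stackStep_bind_searchStack {st : List (ℕ × Finset (Fin n))} (hst : ∀ p ∈ st, p.1 ≤ n)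
    (acc : List (Finset (Fin n))) :
    ((B.stackStep f θ m₁ (st, acc)).bind fun x => B.searchStack f θ m₁ x.1 x.2) =
      B.searchStack f θ m₁ st acc := by
  match st with
  | [] => simp [stackStep, PMF.pure_bind]
  | (0, S) :: rest =>
    rw [stackStep, PMF.bind_map, searchStack, dif_pos (Nat.zero_le n), search, PMF.bind_bind]
    congr 1
    funext G
    by_cases h : θ ^ 2 / 2 ≤ G <;> simp [h, expand, PMF.pure_bind]
  | (m + 1, S) :: rest =>
    have hm : m + 1 ≤ n := hst _ List.mem_cons_self
    rw [stackStep, PMF.bind_map, searchStack, dif_pos hm, search, PMF.bind_bind]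
    congr 1
    funext G
    by_cases h : θ ^ 2 / 2 ≤ G
    · simp only [Function.comp_apply, if_pos h, expand, searchStack, dif_pos (Nat.le_of_succ_le hm),
        addIndex_of_lt hm, PMF.bind_bind, PMF.bind_map]
      simp only [Function.comp_def, List.append_assoc]
    · simp [h, PMF.pure_bind]

theorem levels_le_of_mem_support {st : List (ℕ × Finset (Fin n))} (hst : ∀ p ∈ st, p.1 ≤ n)
    {acc : List (Finset (Fin n))} {x : List (ℕ × Finset (Fin n)) × List (Finset (Fin n))}
    (hx : x ∈ (B.stackStep f θ m₁ (st, acc)).support) : ∀ p ∈ x.1, p.1 ≤ n := by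
  match st with
  | [] =>
    rw [stackStep, PMF.mem_support_pure_iff] at hx
    subst hx
    simp
  | (m, S) :: rest =>
    rw [stackStep, PMF.support_map] at hx
    obtain ⟨G, -, rfl⟩ := hx
    have hm : m ≤ n := hst _ List.mem_cons_self
    have hrest : ∀ p ∈ rest, p.1 ≤ n := fun p hp => hst p (List.mem_cons_of_mem _ hp)
    by_cases h : θ ^ 2 / 2 ≤ G
    · match m with
      | 0 => simpa [h, expand] using fun a b => hrest (a, b)
      | m + 1 =>
        simp only [h, if_true, expand, List.mem_cons]
        rintro p (rfl | rfl | hp)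
        · exact Nat.le_of_succ_le hm
        · exact Nat.le_of_succ_le hm
        · exact hrest p hp
    · simpa [h] using fun a b => hrest (a, b)

/-- A run that has emptied its stack within `K` steps agrees with the unlimited search. Runs with
pending calls are missing on the left, whence an inequality. -/
theorem iterSteps_stackStep_le (K i : ℕ) {st : List (ℕ × Finset (Fin n))}
    (hst : ∀ p ∈ st, p.1 ≤ n) (acc l : List (Finset (Fin n))) :
    iterSteps (fun _ => B.stackStep f θ m₁) i K (st, acc) ([], l) ≤
      B.searchStack f θ m₁ st acc l := by
  induction K generalizing i st acc with
  | zero =>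
    match st with
    | [] => by_cases h : l = acc <;> simp [iterSteps, searchStack, PMF.pure_apply, h]
    | p :: rest => simp [iterSteps, PMF.pure_apply]
  | succ K ih =>
    rw [← stackStep_bind_searchStack B f hst, iterSteps, PMF.bind_apply, PMF.bind_apply]
    refine ENNReal.tsum_le_tsum fun x => ?_
    by_cases hx : x ∈ (B.stackStep f θ m₁ (st, acc)).support
    · exact mul_le_mul_right (ih (i + 1) (B.levels_le_of_mem_support f hst hx) x.2) _
    · rw [(PMF.apply_eq_zero_iff _ _).2 hx, zero_mul, zero_mul]

theorem _root_.PMF.map_some_apply {α : Type*} (p : PMF α) (a : α) : p.map some (some a) = p a := by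
  rw [PMF.map_apply, tsum_eq_single a fun b hb => by simp [Ne.symm hb]]
  simp

/-- Aborting only lowers the probabilities of the results. -/
theorem boundedKM_le_extendedKM (m₂ K : ℕ) (r : List (Finset (Fin n) × ℝ)) :
    B.boundedKM f θ m₁ m₂ K (some r) ≤ B.extendedKM f θ m₁ m₂ r := by
  have hs : B.searchStack f θ m₁ [(n, ∅)] [] = B.search f θ m₁ n le_rfl ∅ := by
    simp [searchStack, PMF.bind_pure]
  rw [boundedKM, extendedKM, PMF.bind_apply, PMF.bind_apply, ENNReal.tsum_prod',
    tsum_eq_single [] fun st hst => by simp [hst]]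
  refine ENNReal.tsum_le_tsum fun l => ?_
  rw [if_pos rfl, PMF.map_some_apply, ← hs]
  exact mul_le_mul_left (B.iterSteps_stackStep_le f K 0 (by simp) [] l) _

/-- The pointwise comparison summed over the good lists. Through it the unbounded algorithm inherits
the success probability of the bounded one. -/
theorem boundedKM_toOuterMeasure_le (θ : ℝ) (m₁ m₂ K : ℕ)
    {p : List (Finset (Fin n) × ℝ) → (Cube n → ℝ) → Prop} :
    (B.boundedKM f θ m₁ m₂ K).toOuterMeasure {o | ∃ l h, o = some l ∧ p l h} ≤
      (B.extendedKM f θ m₁ m₂).toOuterMeasure {l | ∃ h, p l h} := by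
  rw [PMF.toOuterMeasure_apply, PMF.toOuterMeasure_apply,
    ← (Option.some_injective _).tsum_eq fun o ho => ?_]
  · refine ENNReal.tsum_le_tsum fun l => ?_
    by_cases hl : ∃ h, p l h
    · rw [Set.indicator_of_mem (by simpa using hl), Set.indicator_of_mem (by exact hl)]
      exact B.boundedKM_le_extendedKM f m₂ K l
    · rw [Set.indicator_of_notMem (by simpa using hl)]
      exact zero_le
  · have := Set.mem_of_indicator_ne_zero ho
    obtain ⟨l, h, rfl, -⟩ := this
    exact ⟨l, rfl⟩

/-! ### Correctness with high probability -/

/-- The number of calls made for `(m, S)` if all the calls with weight below `θ² / 4` are rejected. -/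
def callBound (θ : ℝ) : ℕ → Finset (Fin n) → ℕ
  | 0, _ => 1
  | m + 1, S => 1 + if θ ^ 2 / 4 ≤ B.weight f (m + 1) S then
      callBound θ m S + callBound θ m (addIndex m S) else 0

theorem one_le_callBound (m : ℕ) (S : Finset (Fin n)) : 1 ≤ B.callBound f θ m S := by
  cases m <;> simp [callBound]

theorem forall_mem_addIndex {m : ℕ} (h : m < n) {S : Finset (Fin n)} (hS : ∀ v ∈ S, m + 1 ≤ v.1) :
    ∀ v ∈ addIndex m S, m ≤ v.1 := by
  rw [addIndex_of_lt h]
  intro v hv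
  rcases Finset.mem_insert.1 hv with rfl | hv
  · exact le_rfl
  · exact Nat.le_of_succ_le (hS v hv)

/-- An accepted node has $8W/\theta^2\ge2$, which pays for the calls of its two children. Since the
weights of the children add up to $W$, each level costs at most $8W/\theta^2$. -/
theorem callBound_le (hθ : 0 < θ) (m : ℕ) (hm : m ≤ n) (S : Finset (Fin n))
    (hS : ∀ v ∈ S, m ≤ v.1) :
    (B.callBound f θ m S : ℝ) ≤ 1 + 8 / θ ^ 2 * m * B.weight f m S := by
  induction m generalizing S with
  | zero => simp [callBound]
  | succ m ih =>
    have hw := B.weight_nonneg f (m + 1) S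
    rw [callBound]
    split_ifs with h
    · have h0 := ih (by omega) S fun v hv => Nat.le_of_succ_le (hS v hv)
      have h1 := ih (by omega) (addIndex m S) (forall_mem_addIndex hm hS)
      have h2 := B.weight_succ f hm hS
      rw [← addIndex_of_lt hm] at h2
      have h3 : 2 ≤ 8 / θ ^ 2 * B.weight f (m + 1) S := by
        rw [div_mul_eq_mul_div, le_div_iff₀ (by positivity)]
        linarith
      have h4 : 8 / θ ^ 2 * m * B.weight f (m + 1) S =
          8 / θ ^ 2 * m * B.weight f m S + 8 / θ ^ 2 * m * B.weight f m (addIndex m S) := by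
        rw [h2]; ring
      push_cast
      linarith
    · have : 0 ≤ 8 / θ ^ 2 * ((m + 1 : ℕ) : ℝ) * B.weight f (m + 1) S := by positivity
      simpa using this

/-! ### The invariant of the search under accurate estimates. -/

/-- Whether `T` is one of the sets that the call for `p` may return. -/
def covers (T : Finset (Fin n)) (p : ℕ × Finset (Fin n)) : ℕ :=
  if T.filter (fun v => p.1 ≤ v.1) = p.2 then 1 else 0

theorem covers_zero (T S : Finset (Fin n)) : covers T (0, S) = if T = S then 1 else 0 := by
  simp [covers]

/-- The sets below a node split according to whether they contain $m$. Numerical values rather than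
a predicate let the occurrences be summed over the whole stack. -/
theorem covers_succ {m : ℕ} (h : m < n) {S : Finset (Fin n)} (hS : ∀ v ∈ S, m + 1 ≤ v.1)
    (T : Finset (Fin n)) :
    covers T (m + 1, S) = covers T (m, S) + covers T (m, addIndex m S) := by
  have hmS : (⟨m, h⟩ : Fin n) ∉ S := fun hmem => by simpa using hS _ hmem
  rw [addIndex_of_lt h]
  simp only [covers]
  by_cases hm : (⟨m, h⟩ : Fin n) ∈ T
  · rw [Finset.filter_le_eq_insert hm, if_neg (c := insert _ _ = S), zero_add]
    · refine if_congr ⟨fun h => by rw [h], fun h' => ?_⟩ rfl rfl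
      have := congrArg (fun U => U.erase ⟨m, h⟩) h'
      simpa [Finset.erase_insert, hmS] using this
    · intro h'
      exact hmS (h' ▸ Finset.mem_insert_self _ _)
  · rw [Finset.filter_le_eq_of_notMem hm, if_neg (c := _ = insert _ _), add_zero]
    intro h'
    have : (⟨m, h⟩ : Fin n) ∈ T.filter fun v => m + 1 ≤ v.1 := h' ▸ Finset.mem_insert_self _ _
    simp at this

/-- The invariant of the search as long as all the estimates are accurate. -/
structure SearchInv (θ : ℝ) (st : List (ℕ × Finset (Fin n))) (acc : List (Finset (Fin n))) :
    Prop where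
  level_le : ∀ p ∈ st, p.1 ≤ n ∧ ∀ v ∈ p.2, p.1 ≤ v.1
  -- Found and pending occurrences are counted together. On an empty stack, at most one means that
  -- the output has no repetitions, and at least one that no heavy set is missing.
  once : ∀ T, acc.count T + (st.map (covers T)).sum ≤ 1
  heavy : ∀ T, θ ≤ |B.coeff f T| → 1 ≤ acc.count T + (st.map (covers T)).sum
  large : ∀ T ∈ acc, θ ^ 2 / 4 ≤ B.coeff f T ^ 2
  total : (acc.map fun T => B.coeff f T ^ 2).sum + (st.map fun p => B.weight f p.1 p.2).sum ≤ 1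

theorem SearchInv.init (hf : ∀ x, |f x| ≤ 1) : B.SearchInv f θ [(n, ∅)] [] where
  level_le := by simp
  once T := by
    simp only [List.count_nil, List.map_cons, List.map_nil, List.sum_cons, List.sum_nil, covers]
    split_ifs <;> simp
  heavy T _ := by
    have : T.filter (fun v => n ≤ v.1) = ∅ := Finset.filter_false_of_mem fun v _ => not_le.2 v.2
    simp [covers, this]
  large := by simp
  total := by simpa using B.weight_root_le f hf

variable {B f}

/-- Each set found uses up at least $\theta^2/4$ of the total weight $1$. -/
theorem SearchInv.length_le (hθ : 0 < θ) {acc : List (Finset (Fin n))}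
    (h : B.SearchInv f θ [] acc) : (acc.length : ℝ) ≤ 4 / θ ^ 2 := by
  have h1 : acc.length • (θ ^ 2 / 4) ≤ (acc.map fun T => B.coeff f T ^ 2).sum := by
    have := List.card_nsmul_le_sum (acc.map fun T => B.coeff f T ^ 2) (θ ^ 2 / 4) (by
      simpa using h.large)
    simpa using this
  have h2 := h.total
  simp only [List.map_nil, List.sum_nil, add_zero] at h2
  rw [nsmul_eq_mul] at h1
  rw [le_div_iff₀ (by positivity)]
  linarith

/-- Expanding a node preserves coverage and total weight exactly, by `covers_succ` and
`weight_succ`. At a leaf the weight is the squared coefficient, so its lower bound passes to the set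
found. -/
theorem SearchInv.accept {m : ℕ} {S : Finset (Fin n)} {rest : List (ℕ × Finset (Fin n))}
    {acc : List (Finset (Fin n))} (h : B.SearchInv f θ ((m, S) :: rest) acc)
    (hw : θ ^ 2 / 4 ≤ B.weight f m S) :
    B.SearchInv f θ (expand m S rest acc).1 (expand m S rest acc).2 := by
  obtain ⟨h1, h2, h3, h4, h5⟩ := h
  have h1' := h1 (m, S) List.mem_cons_self
  have hr : ∀ p ∈ rest, p.1 ≤ n ∧ ∀ v ∈ p.2, p.1 ≤ v.1 := fun p hp =>
    h1 p (List.mem_cons_of_mem _ hp)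
  match m with
  | 0 =>
    have hcount : ∀ T, (acc ++ [S]).count T + (rest.map (covers T)).sum =
        acc.count T + (((0, S) :: rest).map (covers T)).sum := fun T => by
      rw [List.map_cons, List.sum_cons, covers_zero, List.count_append, List.count_singleton]
      simp only [beq_iff_eq, eq_comm (a := S)]
      omega
    rw [weight_zero] at hw
    refine ⟨hr, fun T => (hcount T).trans_le (h2 T), fun T hT => (h3 T hT).trans_eq (hcount T).symm,
      fun T hT => ?_, ?_⟩
    · rcases List.mem_append.1 hT with hT | hT
      · exact h4 T hT
      · rw [List.mem_singleton.1 hT]; exact hw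
    · simp only [List.map_cons, List.sum_cons, weight_zero] at h5
      simp only [expand, List.map_append, List.sum_append, List.map_cons, List.map_nil,
        List.sum_cons, List.sum_nil]
      linarith
  | m + 1 =>
    have hm : m < n := h1'.1
    have hcount : ∀ T, (((m, S) :: (m, addIndex m S) :: rest).map (covers T)).sum =
        (((m + 1, S) :: rest).map (covers T)).sum := fun T => by
      simp only [List.map_cons, List.sum_cons]
      rw [covers_succ (S := S) hm h1'.2]
      omega
    refine ⟨?_, fun T => ?_, fun T hT => ?_, h4, ?_⟩
    · intro p hp
      simp only [expand, List.mem_cons] at hp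
      rcases hp with rfl | rfl | hp
      · exact ⟨hm.le, fun v hv => Nat.le_of_succ_le (h1'.2 v hv)⟩
      · exact ⟨hm.le, forall_mem_addIndex hm h1'.2⟩
      · exact hr p hp
    · simp only [expand, hcount]; exact h2 T
    · simp only [expand, hcount]; exact h3 T hT
    · have := B.weight_succ f hm h1'.2
      rw [← addIndex_of_lt hm] at this
      simp only [List.map_cons, List.sum_cons, this] at h5
      simp only [expand, List.map_cons, List.sum_cons]
      linarith

/-- The sets lost have squared coefficient at most the weight of the rejected node, so none of them
is heavy. -/
theorem SearchInv.reject (hθ : 0 < θ) {m : ℕ} {S : Finset (Fin n)}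
    {rest : List (ℕ × Finset (Fin n))}
    {acc : List (Finset (Fin n))} (h : B.SearchInv f θ ((m, S) :: rest) acc)
    (hw : B.weight f m S < θ ^ 2) : B.SearchInv f θ rest acc := by
  obtain ⟨h1, h2, h3, h4, h5⟩ := h
  refine ⟨fun p hp => h1 p (List.mem_cons_of_mem _ hp), fun T => ?_, fun T hT => ?_, h4, ?_⟩
  · refine le_trans ?_ (h2 T)
    simp
  · have h6 := h3 T hT
    rw [List.map_cons, List.sum_cons, covers, if_neg, zero_add] at h6
    · exact h6
    · intro h7
      have h8 := B.coeff_sq_le_weight f T m (h1 (m, S) List.mem_cons_self).1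
      have h9 : θ ^ 2 ≤ B.coeff f T ^ 2 := by
        rw [← sq_abs (B.coeff f T)]
        gcongr
      rw [h7] at h8
      linarith
  · have := B.weight_nonneg f m S
    simp only [List.map_cons, List.sum_cons] at h5
    linarith

variable (B f)

/-- A union bound over calls that are not known in advance. The sum of `callBound` over the stack is
a potential: each accurate call lowers it by at least one, and an inaccurate call is charged to the
failure probability. -/
theorem search_failure_le (hf : ∀ x, |f x| ≤ 1) (hθ : 0 < θ) (hm₁ : 0 < m₁) (K i : ℕ)
    {st : List (ℕ × Finset (Fin n))} {acc : List (Finset (Fin n))} (hinv : B.SearchInv f θ st acc)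
    (hK : (st.map fun p => B.callBound f θ p.1 p.2).sum ≤ K) :
    (iterSteps (fun _ => B.stackStep f θ m₁) i K (st, acc)).toOuterMeasure
        {x | ¬ (x.1 = [] ∧ B.SearchInv f θ x.1 x.2)} ≤
      (st.map fun p => B.callBound f θ p.1 p.2).sum *
        ENNReal.ofReal (1 / (m₁ * (θ ^ 2 / 4) ^ 2)) := by
  induction K generalizing i st acc with
  | zero =>
    match st with
    | [] => simp [iterSteps, PMF.toOuterMeasure_pure_apply, hinv]
    | p :: rest =>
      have := B.one_le_callBound f (θ := θ) p.1 p.2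
      simp only [List.map_cons, List.sum_cons] at hK
      omega
  | succ K ih =>
    match st with
    | [] =>
      rw [iterSteps, stackStep, PMF.pure_bind]
      exact ih (i + 1) hinv (by simp)
    | (m, S) :: rest =>
      have hlev := hinv.level_le (m, S) List.mem_cons_self
      have h1 := B.one_le_callBound f (θ := θ) m S
      simp only [List.map_cons, List.sum_cons] at hK ⊢
      rw [iterSteps, stackStep, PMF.bind_map]
      have hacc := empiricalMean_inaccurate_le (B.pairSample_support_finite f m S)
        (B.pairSample_mean f m S) (B.pairSample_sq_le f hf hlev.1 hlev.2) hm₁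
        (ε := θ ^ 2 / 4) (by positivity)
      -- The current call accounts for one unit of the potential; the remainder bounds the failure
      -- after an accurate estimate.
      refine (toOuterMeasure_bind_le _ (c := ((B.callBound f θ m S - 1 +
        (rest.map fun p => B.callBound f θ p.1 p.2).sum : ℕ) : ENNReal) *
          ENNReal.ofReal (1 / (m₁ * (θ ^ 2 / 4) ^ 2))) fun G hG => ?_).trans
        ((add_le_add_left hacc _).trans_eq ?_)
      · simp only [Set.mem_ofPred_eq, not_le, abs_lt] at hG
        rw [Function.comp_apply]
        by_cases h : θ ^ 2 / 2 ≤ G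
        · rw [if_pos h]
          -- The threshold $\theta^2/2$ minus the error $\theta^2/4$.
          have hw : θ ^ 2 / 4 ≤ B.weight f m S := by linarith
          have hinv' := hinv.accept hw
          have hsum : ((expand m S rest acc).1.map fun p => B.callBound f θ p.1 p.2).sum ≤
              B.callBound f θ m S - 1 + (rest.map fun p => B.callBound f θ p.1 p.2).sum := by
            match m with
            | 0 => simp [expand]
            | m + 1 =>
              simp only [expand, List.map_cons, List.sum_cons]
              rw [callBound.eq_def B f θ (m + 1) S]
              simp only [if_pos hw]
              omega
          refine (ih (i + 1) hinv' (hsum.trans (by omega))).trans ?_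
          gcongr
        · rw [if_neg h]
          -- Here the weight is below $\theta^2/2+\theta^2/4<\theta^2$.
          refine (ih (i + 1) (hinv.reject hθ (by nlinarith)) (by omega)).trans ?_
          gcongr
          exact Nat.le_add_left _ _
      · have : B.callBound f θ m S + (rest.map fun p => B.callBound f θ p.1 p.2).sum =
          1 + (B.callBound f θ m S - 1 + (rest.map fun p => B.callBound f θ p.1 p.2).sum) := by
          omega
        rw [this]
        push_cast
        ring

/-- A union bound over the list, which is already fixed when the fresh samples are drawn. -/
theorem estimate_failure_le (hf : ∀ x, |f x| ≤ 1) {γ : ℝ} (hγ : 0 < γ) {m₂ : ℕ} (hm₂ : 0 < m₂)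
    (l : List (Finset (Fin n))) :
    (B.estimate f m₂ l).toOuterMeasure
        {r | ¬ (r.map Prod.fst = l ∧ ∀ p ∈ r, |p.2 - B.coeff f p.1| ≤ γ)} ≤
      l.length * ENNReal.ofReal (1 / (m₂ * γ ^ 2)) := by
  induction l with
  | nil => simp [estimate, PMF.toOuterMeasure_pure_apply]
  | cons S l ih =>
    rw [estimate]
    have hacc := empiricalMean_inaccurate_le (B.coeffSample_support_finite f S)
        (B.coeffSample_mean f S) (B.coeffSample_sq_le f hf S) hm₂ hγ
    refine (toOuterMeasure_bind_le _ fun c hc => ?_).trans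
      ((add_le_add_left hacc (l.length * ENNReal.ofReal (1 / (m₂ * γ ^ 2)))).trans_eq ?_)
    · simp only [Set.mem_ofPred_eq, not_le] at hc
      rw [PMF.toOuterMeasure_map_apply]
      refine le_trans (MeasureTheory.measure_mono ?_) ih
      intro r hr hr'
      refine hr ?_
      refine ⟨by rw [List.map_cons, hr'.1], fun p hp => ?_⟩
      rcases List.mem_cons.1 hp with rfl | hp
      · exact hc.le
      · exact hr'.2 p hp
    · rw [List.length_cons]
      push_cast
      ring

/-! ### Sample sizes and the total probability of failure. -/

/-- The bound on the number of calls of the search. -/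
def callBudget (n : ℕ) (θ : ℝ) : ℝ := 1 + 8 * n / θ ^ 2

/-- The bound on the number of samples for one call of the search. -/
def searchBudget (n : ℕ) (θ δ : ℝ) : ℝ := 32 * callBudget n θ / (θ ^ 4 * δ)

/-- The bound on the number of samples for the estimate of one coefficient. -/
def coeffBudget (θ γ δ : ℝ) : ℝ := 8 / (θ ^ 2 * γ ^ 2 * δ)

/-- The search and the estimation may each fail with probability $\delta/2$. Rounding a budget down
and adding one gives a positive integer that is at least the budget. -/
theorem boundedKM_failure_le (hf : ∀ x, |f x| ≤ 1) (hθ : 0 < θ) {γ δ : ℝ} (hγ : 0 < γ)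
    (hδ : 0 < δ) :
    (B.boundedKM f θ (⌊searchBudget n θ δ⌋₊ + 1) (⌊coeffBudget θ γ δ⌋₊ + 1)
      (⌊callBudget n θ⌋₊ + 1)).toOuterMeasure
        {o | ∃ l h, o = some l ∧ B.IsGoodOutput f θ γ l h}ᶜ ≤ ENNReal.ofReal δ := by
  have hcall : (B.callBound f θ n ∅ : ℝ) ≤ callBudget n θ := by
    refine (B.callBound_le f hθ n le_rfl ∅ (by simp)).trans ?_
    have h := mul_le_mul_of_nonneg_left (B.weight_root_le f hf)
      (show 0 ≤ 8 / θ ^ 2 * (n : ℝ) by positivity)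
    rw [callBudget, mul_div_right_comm]
    linarith
  have hcb : 0 < callBudget n θ := by unfold callBudget; positivity
  have h1 := B.search_failure_le f hf hθ (Nat.succ_pos ⌊searchBudget n θ δ⌋₊)
    (⌊callBudget n θ⌋₊ + 1) 0 (SearchInv.init B f hf) (by
      simp only [List.map_cons, List.map_nil, List.sum_cons, List.sum_nil, add_zero]
      exact_mod_cast hcall.trans (Nat.lt_floor_add_one _).le)
  simp only [List.map_cons, List.map_nil, List.sum_cons, List.sum_nil, add_zero] at h1
  have h1' : (B.callBound f θ n ∅ : ENNReal) * ENNReal.ofReal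
      (1 / ((⌊searchBudget n θ δ⌋₊.succ : ℕ) * (θ ^ 2 / 4) ^ 2)) ≤ ENNReal.ofReal (δ / 2) := by
    rw [← ENNReal.ofReal_natCast, ← ENNReal.ofReal_mul (by positivity)]
    refine ENNReal.ofReal_le_ofReal ?_
    have h2 : searchBudget n θ δ ≤ (⌊searchBudget n θ δ⌋₊.succ : ℕ) := by
      push_cast; exact (Nat.lt_floor_add_one _).le
    rw [mul_one_div, div_le_iff₀ (by positivity)]
    refine hcall.trans ?_
    -- One call fails with probability at most $16/(m_1\theta^4)$; the constant $32$ brings the sum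
    -- over all calls down to $\delta/2$.
    have h3 : callBudget n θ = δ / 2 * (searchBudget n θ δ * (θ ^ 2 / 4) ^ 2) := by
      rw [searchBudget]; field_simp; ring
    conv_lhs => rw [h3]
    gcongr
  have h2 : ∀ l, B.SearchInv f θ [] l → (l.length : ENNReal) * ENNReal.ofReal
      (1 / ((⌊coeffBudget θ γ δ⌋₊ + 1 : ℕ) * γ ^ 2)) ≤ ENNReal.ofReal (δ / 2) := by
    intro l hl
    rw [← ENNReal.ofReal_natCast, ← ENNReal.ofReal_mul (by positivity)]
    refine ENNReal.ofReal_le_ofReal ?_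
    have h2 : coeffBudget θ γ δ ≤ (⌊coeffBudget θ γ δ⌋₊ + 1 : ℕ) := by
      push_cast; exact (Nat.lt_floor_add_one _).le
    rw [mul_one_div, div_le_iff₀ (by positivity)]
    refine (hl.length_le hθ).trans ?_
    -- With at most $4/\theta^2$ sets, each failing with probability at most $1/(m_2\gamma^2)$, the
    -- constant $8$ leaves $\delta/2$.
    have h3 : 4 / θ ^ 2 = δ / 2 * (coeffBudget θ γ δ * γ ^ 2) := by
      rw [coeffBudget]; field_simp; ring
    rw [h3]
    gcongr
  rw [boundedKM]
  refine (toOuterMeasure_bind_le {x | ¬ (x.1 = [] ∧ B.SearchInv f θ x.1 x.2)}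
    (c := ENNReal.ofReal (δ / 2)) fun x hx => ?_).trans ((add_le_add_left (h1.trans h1') _).trans_eq
      (by rw [← ENNReal.ofReal_add (by positivity) (by positivity), add_halves]))
  obtain ⟨st, l⟩ := x
  simp only [Set.mem_ofPred_eq, not_not] at hx
  obtain ⟨rfl, hinv⟩ := hx
  rw [if_pos rfl, PMF.toOuterMeasure_map_apply]
  refine le_trans (MeasureTheory.measure_mono ?_)
    ((B.estimate_failure_le f hf hγ (Nat.succ_pos ⌊coeffBudget θ γ δ⌋₊) l).trans (h2 l hinv))
  intro r hr hr'
  refine hr ?_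
  obtain ⟨hr1, hr2⟩ := hr'
  have hlen : r.length = l.length := by rw [← hr1, List.length_map]
  refine ⟨r, _, rfl, ?_, ?_, ?_, hr2, fun x => rfl⟩
  · rw [hr1]
    exact List.nodup_iff_count_le_one.2 fun T => by simpa using hinv.once T
  · intro T hT
    rw [hr1]
    exact List.count_pos_iff.1 (by simpa using hinv.heavy T hT)
  · rw [hlen]
    exact hinv.length_le hθ

end BayesNet
end

noncomputable section

/-! ### Subprograms

The integer variables `7` and `8` are an index and the result of a coin toss, `6` counts samples,
`4` is the level of the current call, `10` is the row of the current set. The real variables `6` to `10`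
are scratch variables. Row `0` of the integer arrays `3` and `4` holds points of the cube; array `5` is
never written. -/

local infixr:60 " ⨟ " => Program.seq

/-- Row `i` of the integer array `a` holds the point `x`, with entries `0` and `1`. -/
def RowHolds {n : ℕ} (s : RamState) (a i : ℕ) (x : Cube n) : Prop :=
  ∀ v : Fin n, s.natArr a i v = if x v then 1 else 0

/-- The indicator of a set as a point of the cube. -/
def setPoint {n : ℕ} (S : Finset (Fin n)) : Cube n := fun v => decide (v ∈ S)

theorem RowHolds.point_eq {n : ℕ} {s : RamState} {a i : ℕ} {x : Cube n} (h : RowHolds s a i x) :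
    s.point n a i = x := by
  funext v
  rw [RamState.point, h v]
  cases x v <;> simp

namespace Program

/-- Increments an integer variable. -/
def incr (x : ℕ) : Program := instr (.setNat x (.add (.var x) (.const 1)))

def copyRowBody (a : ℕ) (r : NatExpr) (a' : ℕ) (r' : NatExpr) : Program :=
  instr (.setNatArr a' r' (.var 7) (.arr a r (.var 7))) ⨟ incr 7

/-- Copies row `r` of the integer array `a` to row `r'` of `a'`. -/
def copyRow (a : ℕ) (r : NatExpr) (a' : ℕ) (r' : NatExpr) : Program :=
  instr (.setNat 7 (.const 0)) ⨟ loop (.natLt (.var 7) (.var 0)) (copyRowBody a r a' r')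

/-- In `lookup 7 (.var 7)` the first `7` is a real variable, the target, and the second an integer
variable, the node; in `flip 8 (.var 7)` the bias is that real variable. -/
def forwardRowBody (a : ℕ) : Program :=
  instr (.lookup 7 (.var 7) a (.const 0)) ⨟ instr (.flip 8 (.var 7)) ⨟
    instr (.setNatArr a (.const 0) (.var 7) (.var 8)) ⨟ incr 7

/-- Draws the variables with indices from `lo` on, and below the value of the variable `hi`, of the
point in row `0` of the array `a`. -/
def forwardRow (a : ℕ) (lo : NatExpr) (hi : ℕ) : Program :=
  instr (.setNat 7 lo) ⨟ loop (.natLt (.var 7) (.var hi)) (forwardRowBody a)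

def basisRowBody (aS a : ℕ) : Program :=
  ite (.natEq (.arr aS (.var 10) (.var 7)) (.const 0)) (instr .skip)
    (instr (.lookup 7 (.var 7) a (.const 0)) ⨟
      instr (.setReal 8 (.mul (.var 8)
        (.div (.sub (.ofNat (.arr a (.const 0) (.var 7))) (.var 7))
          (.sqrt (.mul (.var 7) (.sub (.ofNat (.const 1)) (.var 7)))))))) ⨟ incr 7

/-- Computes the basis function of the set in row `nat 10` of the array `aS` at the point in row `0` of
the array `a`. -/
def basisRow (aS a : ℕ) : Program :=
  instr (.setNat 7 (.const 0)) ⨟ instr (.setReal 8 (.ofNat (.const 1))) ⨟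
    loop (.natLt (.var 7) (.var 0)) (basisRowBody aS a)

/-- One draw of `f(uY₁) f(uY₂) φ(uY₁) φ(uY₂)`. -/
def pairDraw : Program :=
  copyRow 5 (.const 0) 3 (.const 0) ⨟ forwardRow 3 (.const 0) 4 ⨟
    copyRow 3 (.const 0) 4 (.const 0) ⨟ forwardRow 3 (.var 4) 0 ⨟ forwardRow 4 (.var 4) 0 ⨟
    instr (.query 9 3 (.const 0)) ⨟ instr (.query 10 4 (.const 0)) ⨟
    instr (.setReal 9 (.mul (.var 9) (.var 10))) ⨟
    basisRow 1 3 ⨟ instr (.setReal 9 (.mul (.var 9) (.var 8))) ⨟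
    basisRow 1 4 ⨟ instr (.setReal 9 (.mul (.var 9) (.var 8)))

/-- One draw of `f(X) φ_S(X)`. -/
def coeffDraw : Program :=
  copyRow 5 (.const 0) 3 (.const 0) ⨟ forwardRow 3 (.const 0) 0 ⨟
    instr (.query 9 3 (.const 0)) ⨟ basisRow 0 3 ⨟ instr (.setReal 9 (.mul (.var 9) (.var 8)))

def meanDrawsBody (P : Program) : Program :=
  P ⨟ instr (.setReal 6 (.add (.var 6) (.var 9))) ⨟ incr 6

/-- The mean of draws by `P`, as many as there are natural numbers up to the real variable `b`. -/
def meanDraws (P : Program) (b : ℕ) : Program :=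
  instr (.setNat 6 (.const 0)) ⨟ instr (.setReal 6 (.ofNat (.const 0))) ⨟
    loop (.realLe (.ofNat (.var 6)) (.var b)) (meanDrawsBody P) ⨟
    instr (.setReal 6 (.div (.var 6) (.ofNat (.var 6))))

end Program

/-! ### Correctness and cost of the sampling subprograms. -/

section Subprograms

open Program

variable {n : ℕ} {B : BayesNet n} {f : Cube n → ℝ} {s : RamState}

theorem RamState.setNat_nat (s : RamState) (x k y : ℕ) :
    (s.setNat x k).nat y = if y = x then k else s.nat y := Function.update_apply _ _ _ _

theorem RamState.setReal_real (s : RamState) (x : ℕ) (r : ℝ) (y : ℕ) :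
    (s.setReal x r).real y = if y = x then r else s.real y := Function.update_apply _ _ _ _

theorem RamState.setNatArr_natArr (s : RamState) (a i j k a' i' j' : ℕ) :
    (s.setNatArr a i j k).natArr a' i' j' =
      if a' = a ∧ i' = i ∧ j' = j then k else s.natArr a' i' j' := rfl

/-- `hr` and `hr'` say that the row expressions do not depend on the loop counter, integer variable
`7`; `hne` keeps the copy from overwriting its source. The statement on the other rows is needed
because `Frame` only speaks of whole arrays. -/
theorem copyRow_simulates {a a' k k' : ℕ} {r r' : NatExpr} (hn : s.nat 0 = n)
    (hr : ∀ s' : RamState, (∀ x, x ≠ 7 → s'.nat x = s.nat x) → r.eval s' = k)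
    (hr' : ∀ s' : RamState, (∀ x, x ≠ 7 → s'.nat x = s.nat x) → r'.eval s' = k')
    (hc : r.cost = 1) (hc' : r'.cost = 1) (hne : a ≠ a' ∨ k ≠ k') :
    Simulates B f (copyRow a r a' r') s (PMF.pure ()) (40 * (n + 1) ^ 2) fun _ s' =>
      (∀ j < n, s'.natArr a' k' j = s.natArr a k j) ∧
      ∀ i j, i ≠ k' → s'.natArr a' i j = s.natArr a' i j := by
  unfold copyRow
  apply Simulates.of_le
  · apply Simulates.step_setNat
    refine Simulates.mono (Simulates.loop_pure (N := n) (T := 11)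
      (Inv := fun i s' => s'.nat 7 = i ∧ (∀ j < i, s'.natArr a' k' j = s.natArr a k j) ∧
        ∀ i j, i ≠ k' → s'.natArr a' i j = s.natArr a' i j) ?_ ?_ ?_) ?_
    · exact ⟨rfl, fun j hj => absurd hj (Nat.not_lt_zero j), fun _ _ _ => rfl⟩
    · rintro i s' hi ⟨h7, hcopy, hother⟩ hF
      have hnat : ∀ x, x ≠ 7 → s'.nat x = s.nat x := fun x hx => by
        rw [hF.nat x (by simp [copyRowBody, incr, Program.any, Instr.writesNat, hx]),
          RamState.setNat_nat, if_neg hx]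
      have hsrc : s'.natArr a k i = s.natArr a k i := by
        by_cases h : a = a'
        · subst h
          exact hother k i (hne.resolve_left fun h => h rfl)
        · rw [hF.natArr a (by simp [copyRowBody, incr, Program.any, Instr.writesNatArr, h])]
          rfl
      refine ⟨?_, Simulates.of_le (Simulates.step (by rfl) (Simulates.instr (by rfl) ?_)) ?_⟩
      · simp only [TestExpr.Holds, NatExpr.eval, h7, hnat 0 (by decide), hn]
        exact hi
      · simp only [NatExpr.eval, hr s' hnat, hr' s' hnat, h7]
        refine ⟨?_, fun j hj => ?_, fun i' j hi' => ?_⟩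
        · rw [RamState.setNat_nat, if_pos rfl]
          exact congrArg (· + 1) h7
        · change (if a' = a' ∧ k' = k' ∧ j = i then _ else _) = _
          by_cases hji : j = i
          · simp [hji, hsrc]
          · simp [hji, hcopy j (by omega)]
        · change (if a' = a' ∧ i' = k' ∧ j = i then _ else _) = _
          simp [hi', hother i' j hi']
      · simp [Instr.cost, NatExpr.cost, hc, hc']
    · rintro s' ⟨h7, -⟩ hF
      have h0 : s'.nat 0 = n := by
        rw [hF.nat 0 (by simp [copyRowBody, incr, Program.any, Instr.writesNat]),
          RamState.setNat_nat, if_neg (by decide), hn]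
      simp [TestExpr.Holds, NatExpr.eval, h7, h0]
    · rintro ⟨⟩ s' ⟨-, h⟩ -
      exact h
  · simp only [NatExpr.cost, TestExpr.cost]
    nlinarith


theorem RowHolds.of_eq {s' : RamState} {a i : ℕ} {x : Cube n} (h : RowHolds s a i x)
    (he : s'.natArr a = s.natArr a) : RowHolds s' a i x := fun v => by rw [he]; exact h v

/-- Puts forward sampling into the form of a counted loop. The step has to be defined for all
counters; its `PMF.pure` branch is never reached since $l+k\le n$. -/
theorem forward_eq_iterSteps (l k : ℕ) (h : l + k ≤ n) (i : ℕ) (x : Cube n) :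
    iterSteps (fun i y => if hi : l + i < n then
      (coin (B.mean ⟨l + i, hi⟩ y)).map (Function.update y ⟨l + i, hi⟩) else PMF.pure y) i (k - i) x =
    B.forward (((List.finRange n).drop (l + i)).take (k - i)) x := by
  induction hk : k - i generalizing i x with
  | zero => rfl
  | succ j ih =>
    have hi : l + i < n := by omega
    rw [List.drop_eq_getElem_cons (by simpa using hi), List.take_succ_cons, BayesNet.forward,
      iterSteps, dif_pos hi, PMF.bind_map]
    simp only [List.getElem_finRange]
    refine congrArg _ (funext fun b => ?_)
    exact ih (i + 1) _ (by omega)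

/-- The row always holds the current argument of `forward`, including the coordinates not yet drawn,
so each look-up returns the mean at exactly that point. -/
theorem forwardRow_simulates {a l h hi : ℕ} {lo : NatExpr} {x : Cube n} (hx : RowHolds s a 0 x)
    (hlo : lo.eval s = l) (hhi : s.nat hi = h) (hc : lo.cost = 1) (h7 : hi ≠ 7) (h8 : hi ≠ 8)
    (hlh : l ≤ h) (hhn : h ≤ n) :
    Simulates B f (forwardRow a lo hi) s
      (B.forward (((List.finRange n).drop l).take (h - l)) x) (40 * (n + 1) ^ 2)
      fun y s' => RowHolds s' a 0 y := by
  have hvar : ∀ s', Frame (forwardRowBody a) (s.setNat 7 (lo.eval s)) s' → s'.nat hi = h := by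
    intro s' hF
    rw [hF.nat _ (by simp [forwardRowBody, incr, Program.any, Instr.writesNat, h7, h8]),
      RamState.setNat_nat, if_neg h7, hhi]
  unfold forwardRow
  apply Simulates.of_le
  · apply Simulates.step_setNat
    refine Simulates.mono ((Simulates.loop (N := h - l) (T := n + 13) (a := x)
      (step := fun i y => if hi : l + i < n then
        (coin (B.mean ⟨l + i, hi⟩ y)).map (Function.update y ⟨l + i, hi⟩) else PMF.pure y)
      (Inv := fun i y s' => s'.nat 7 = l + i ∧ RowHolds s' a 0 y) ?_ ?_ ?_).law_eq
        (forward_eq_iterSteps l (h - l) (by omega) 0 x)) fun y s' h _ => h.2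
    · exact ⟨by rw [RamState.setNat_nat, if_pos rfl, hlo]; rfl, hx⟩
    · rintro i y s' hi ⟨h7', hy⟩ hF
      have hin : l + i < n := by omega
      refine ⟨?_, ?_⟩
      · simp only [TestExpr.Holds, NatExpr.eval, h7', hvar s' hF]
        omega
      · unfold forwardRowBody incr
        rw [dif_pos hin]
        apply Simulates.of_le
        · apply Simulates.step_lookup
          simp only [NatExpr.eval, h7', dif_pos hin, hy.point_eq]
          refine Simulates.law_eq (Simulates.seq (T' := 8)
            (ν' := fun b => PMF.pure (Function.update y ⟨l + i, hin⟩ b)) (Simulates.flip _ _) ?_) ?_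
          · rintro b s'' rfl -
            refine Simulates.step_setNatArr (T := 4) (Simulates.instr_setNat ⟨?_, fun v => ?_⟩)
            · rw [RamState.setNat_nat, if_pos rfl]
              exact congrArg (· + 1) h7'
            · refine (RamState.setNatArr_natArr ((s'.setReal 7 (B.mean ⟨l + i, hin⟩ y)).setNat 8
                (if b then 1 else 0)) a 0 (s'.nat 7) (if b then 1 else 0) a 0 v).trans ?_
              change (if a = a ∧ 0 = 0 ∧ (v : ℕ) = s'.nat 7 then (if b then 1 else 0)
                else s'.natArr a 0 v) = _
              rw [h7', Function.update_apply, hy v]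
              by_cases hv : (v : ℕ) = l + i
              · rw [if_pos ⟨rfl, rfl, hv⟩, if_pos (Fin.ext hv)]
              · rw [if_neg fun h => hv h.2.2, if_neg fun h => hv (congrArg Fin.val h)]
          · simp [RealExpr.eval, RamState.setReal_real, PMF.map]
            rfl
        · simp only [NatExpr.cost, RealExpr.cost]
          omega
    · rintro y s' ⟨h7', -⟩ hF
      simp only [TestExpr.Holds, NatExpr.eval, h7', hvar s' hF]
      omega
  · simp only [NatExpr.cost, TestExpr.cost, hc]
    have : h - l ≤ n := by omega
    nlinarith

theorem basisRow_simulates {aS a : ℕ} {S : Finset (Fin n)} {x : Cube n} (hn : s.nat 0 = n)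
    (hS : RowHolds s aS (s.nat 10) (setPoint S)) (hx : RowHolds s a 0 x) :
    Simulates B f (basisRow aS a) s (PMF.pure ()) (40 * (n + 1) ^ 2)
      fun _ s' => s'.real 8 = B.basis S x := by
  unfold basisRow
  apply Simulates.of_le
  · apply Simulates.step_setNat
    apply Simulates.step_setReal
    refine Simulates.mono (Simulates.loop_pure (N := n) (T := n + 31)
      (Inv := fun i s' => s'.nat 7 = i ∧
        s'.real 8 = ∏ v ∈ S with v.1 < i, B.factor v x) ?_ ?_ ?_) ?_
    · exact ⟨rfl, by simp [RamState.setReal_real, RealExpr.eval, NatExpr.eval]⟩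
    · rintro i s' hi ⟨h7, h8⟩ hF
      have h0 : s'.nat 0 = n := (hF.nat 0 rfl).trans hn
      have h10 : s'.nat 10 = s.nat 10 := hF.nat 10 rfl
      have hS' : RowHolds s' aS (s.nat 10) (setPoint S) := hS.of_eq (hF.natArr aS rfl)
      have hx' : RowHolds s' a 0 x := hx.of_eq (hF.natArr a rfl)
      have hSi := hS' ⟨i, hi⟩
      refine ⟨?_, ?_⟩
      · simp only [TestExpr.Holds, NatExpr.eval, h7, h0]
        exact hi
      · unfold basisRowBody incr
        refine Simulates.of_le (Simulates.seq_pure (T := n + 27) (T' := 4) (a := ())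
          (R := fun _ s'' => s''.real 8 = ∏ v ∈ S with v.1 < i + 1, B.factor v x) ?_
          fun s'' h8' hF' => Simulates.instr_setNat ⟨?_, h8'⟩) le_rfl
        · by_cases hiS : (⟨i, hi⟩ : Fin n) ∈ S
          · have hset : S.filter (fun v => v.1 < i + 1) =
                insert ⟨i, hi⟩ (S.filter fun v => v.1 < i) := by
              ext v
              simp only [Finset.mem_filter, Finset.mem_insert, Fin.ext_iff]
              constructor
              · rintro ⟨h1, h2⟩
                by_cases h3 : v.1 = i
                · exact Or.inl h3
                · exact Or.inr ⟨h1, by omega⟩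
              · rintro (h1 | ⟨h1, h2⟩)
                · exact ⟨by rwa [show v = ⟨i, hi⟩ from Fin.ext h1], by omega⟩
                · exact ⟨h1, by omega⟩
            apply Simulates.of_le
            · apply Simulates.ite_false
              · simp [TestExpr.Holds, NatExpr.eval, h7, h10, hSi, setPoint, hiS]
              · apply Simulates.step_lookup
                refine Simulates.instr (by rfl) ?_
                rw [hset, Finset.prod_insert (by simp), mul_comm, ← h8, RamState.setReal_real,
                  if_pos rfl]
                have hxi := hx' ⟨i, hi⟩
                simp only [RealExpr.eval, NatExpr.eval, h7, dif_pos hi, hx'.point_eq,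
                  RamState.setReal_real]
                -- Division by zero gives zero on the machine just as in `basis`, so a vanishing
                -- standard deviation needs no test in the program.
                change s'.real 8 * ((((s'.natArr a 0 (s'.nat 7) : ℕ) : ℝ) - B.mean ⟨i, hi⟩ x) /
                  Real.sqrt (B.mean ⟨i, hi⟩ x * (((1 : ℕ) : ℝ) - B.mean ⟨i, hi⟩ x))) = _
                simp only [h7, hxi, BayesNet.factor, BayesNet.sd]
                push_cast
                rfl
            · simp only [NatExpr.cost, RealExpr.cost, TestExpr.cost, Instr.cost]
              omega
          · have hset : S.filter (fun v => v.1 < i + 1) = S.filter fun v => v.1 < i := by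
              refine Finset.filter_congr fun v hv => ⟨fun h => ?_, fun h => by omega⟩
              have : v.1 ≠ i := fun h => hiS (by rwa [← show v = ⟨i, hi⟩ from Fin.ext h])
              omega
            apply Simulates.of_le
            · apply Simulates.ite_true
              · simp [TestExpr.Holds, NatExpr.eval, h7, h10, hSi, setPoint, hiS]
              · exact Simulates.instr (by rfl) (by rw [hset, h8])
            · simp only [NatExpr.cost, TestExpr.cost, Instr.cost]
              omega
        · have h7' : s''.nat 7 = i := (hF'.nat 7 rfl).trans h7
          rw [RamState.setNat_nat, if_pos rfl]
          exact congrArg (· + 1) h7'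
    · rintro s' ⟨h7, -⟩ hF
      have h0 : s'.nat 0 = n := (hF.nat 0 rfl).trans hn
      simp [TestExpr.Holds, NatExpr.eval, h7, h0]
    · rintro ⟨⟩ s' ⟨-, h⟩ -
      rw [h, Finset.filter_true_of_mem fun v _ => v.2, BayesNet.basis_eq_prod_factor]
  · simp only [NatExpr.cost, RealExpr.cost, TestExpr.cost]
    nlinarith

theorem Frame.setNat {P : Program} {x : ℕ} (h : P.any (·.writesNat x) = true) (k : ℕ) :
    Frame P s (s.setNat x k) := by
  refine ⟨fun y hy => ?_, fun _ _ => rfl, fun _ _ => rfl, fun _ _ => rfl⟩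
  rw [RamState.setNat_nat, if_neg]
  rintro rfl
  simp [h] at hy

theorem Frame.setReal {P : Program} {x : ℕ} (h : P.any (·.writesReal x) = true) (r : ℝ) :
    Frame P s (s.setReal x r) := by
  refine ⟨fun _ _ => rfl, fun y hy => ?_, fun _ _ => rfl, fun _ _ => rfl⟩
  rw [RamState.setReal_real, if_neg]
  rintro rfl
  simp [h] at hy

theorem iterSteps_eq_iidSum (ν : PMF ℝ) (k : ℕ) :
    iterSteps (fun _ t => ν.map fun z => t + z) 0 k 0 = iidSum ν k := by
  induction k with
  | zero => rfl
  | succ k ih => rw [iterSteps_succ_right, ih, iidSum]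

/-- The test $i\le b$ succeeds for $i=0,\dots,\lfloor b\rfloor$. This gives $\lfloor b\rfloor+1$
draws without a rounding operation. The subprogram may be arbitrary as long as it spares the
counter, the running sum and the bound. -/
theorem meanDraws_simulates {P : Program} {b T : ℕ} {ν : PMF ℝ} (hb : 0 ≤ s.real b) (hb6 : b ≠ 6)
    (hPn : P.any (·.writesNat 6) = false) (hPr : P.any (·.writesReal 6) = false)
    (hPb : P.any (·.writesReal b) = false)
    (hP : ∀ s', Frame (meanDraws P b) s s' →
      Simulates B f P s' ν T fun z s'' => s''.real 9 = z) :
    Simulates B f (meanDraws P b) s (empiricalMean ν (⌊s.real b⌋₊ + 1))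
      ((⌊s.real b⌋₊ + 1) * (T + 12) + 14) fun G s' => s'.real 6 = G := by
  have hinit : Frame (meanDraws P b) s ((s.setNat 6 0).setReal 6 ((0 : ℕ) : ℝ)) :=
    (Frame.setNat (by simp [meanDraws, Program.any, Instr.writesNat]) _).trans
      (Frame.setReal (by simp [meanDraws, Program.any, Instr.writesReal]) _)
  -- Every draw starts from a memory that differs from `s` only where the whole loop writes, which
  -- is all that `hP` asks for.
  have hsub : ∀ s', Frame (meanDrawsBody P) ((s.setNat 6 0).setReal 6 ((0 : ℕ) : ℝ)) s' →
      Frame (meanDraws P b) s s' := fun s' hF => hinit.trans (hF.of_any_le fun w hw => by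
    simp only [meanDraws, Program.any, Bool.or_eq_false_iff] at hw
    exact hw.2.2.1)
  have hbound : ∀ s', Frame (meanDrawsBody P) ((s.setNat 6 0).setReal 6 ((0 : ℕ) : ℝ)) s' →
      s'.real b = s.real b := fun s' hF => by
    rw [hF.real b (by
        rw [meanDrawsBody, Program.any, hPb]
        simp [incr, Program.any, Instr.writesReal, hb6]), RamState.setReal_real, if_neg hb6]
    rfl
  unfold meanDraws
  apply Simulates.of_le
  · apply Simulates.step_setNat
    apply Simulates.step_setReal
    refine Simulates.law_eq (Simulates.seq (T' := 5)
      (ν' := fun t => PMF.pure (t / ((⌊s.real b⌋₊ + 1 : ℕ) : ℝ)))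
      (Simulates.loop (N := ⌊s.real b⌋₊ + 1) (T := T + 8) (a := (0 : ℝ))
        (step := fun _ t => ν.map fun z => t + z)
        (Inv := fun i t s' => s'.nat 6 = i ∧ s'.real 6 = t) ?_ ?_ ?_) ?_)
        (by rw [iterSteps_eq_iidSum]; rfl)
    · exact ⟨rfl, by simp [RamState.setReal_real, RealExpr.eval, NatExpr.eval]⟩
    · rintro i t s' hi ⟨h6, ht⟩ hF
      refine ⟨?_, ?_⟩
      · simp only [TestExpr.Holds, RealExpr.eval, NatExpr.eval, h6]
        rw [hbound s' hF]
        exact (Nat.le_floor_iff hb).1 (Nat.lt_succ_iff.1 hi)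
      · refine Simulates.law_eq (Simulates.seq (T' := 8) (ν' := fun z => PMF.pure (t + z))
          (hP s' (hsub s' hF)) fun z s'' hz hF' => ?_) rfl
        have h6' : s''.nat 6 = i := (hF'.nat 6 hPn).trans h6
        have ht' : s''.real 6 = t := (hF'.real 6 hPr).trans ht
        refine Simulates.step_setReal (T := 4) (Simulates.instr_setNat ⟨?_, ?_⟩)
        · rw [RamState.setNat_nat, if_pos rfl]
          exact congrArg (· + 1) h6'
        · change (s''.setReal 6 (s''.real 6 + s''.real 9)).real 6 = _
          rw [RamState.setReal_real, if_pos rfl, ht', hz]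
    · rintro t s' ⟨h6, -⟩ hF
      simp only [TestExpr.Holds, RealExpr.eval, NatExpr.eval, h6]
      rw [hbound s' hF, not_le, Nat.cast_add, Nat.cast_one]
      exact Nat.lt_floor_add_one _
    · rintro t s' ⟨h6, ht⟩ -
      refine Simulates.instr (by rfl) ?_
      rw [RamState.setReal_real, if_pos rfl]
      simp [RealExpr.eval, NatExpr.eval, h6, ht]
  · simp only [NatExpr.cost, RealExpr.cost, TestExpr.cost]
    nlinarith

/-- The memory `s'` agrees with `s` in the inputs of the sampling programs. -/
structure SameInputs (s s' : RamState) : Prop where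
  size : s'.nat 0 = s.nat 0
  level : s'.nat 4 = s.nat 4
  row : s'.nat 10 = s.nat 10
  found : s'.natArr 0 = s.natArr 0
  stack : s'.natArr 1 = s.natArr 1

theorem SameInputs.refl (s : RamState) : SameInputs s s := ⟨rfl, rfl, rfl, rfl, rfl⟩

/-- For a concrete program the default arguments are discharged by evaluating the syntactic write
test. -/
theorem SameInputs.trans_frame {s' s'' : RamState} {P : Program} (h : SameInputs s s')
    (hF : Frame P s' s'') (h0 : P.any (·.writesNat 0) = false := by rfl)
    (h4 : P.any (·.writesNat 4) = false := by rfl) (h10 : P.any (·.writesNat 10) = false := by rfl)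
    (ha0 : P.any (·.writesNatArr 0) = false := by rfl)
    (ha1 : P.any (·.writesNatArr 1) = false := by rfl) : SameInputs s s'' :=
  ⟨(hF.nat 0 h0).trans h.size, (hF.nat 4 h4).trans h.level, (hF.nat 10 h10).trans h.row,
    (hF.natArr 0 ha0).trans h.found, (hF.natArr 1 ha1).trans h.stack⟩

theorem SameInputs.setReal {s' : RamState} (h : SameInputs s s') (x : ℕ) (r : ℝ) :
    SameInputs s (s'.setReal x r) := ⟨h.size, h.level, h.row, h.found, h.stack⟩

/-- Row `0` of array `5` is the all-zero point from which `samplePrefix` starts. The prefix is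
copied before it is completed, so that both completions extend the same `u`. -/
theorem pairDraw_simulates {m : ℕ} {S : Finset (Fin n)} (hn : s.nat 0 = n) (hm : s.nat 4 = m)
    (hmn : m ≤ n) (hS : RowHolds s 1 (s.nat 10) (setPoint S))
    (hzero : ∀ j, s.natArr 5 0 j = 0) :
    Simulates B f pairDraw s (B.pairSample f m S) (400 * (n + 1) ^ 2)
      fun z s' => s'.real 9 = z := by
  have hsuffix : ∀ u : Cube n, B.forward (((List.finRange n).drop m).take (n - m)) u =
      B.sampleSuffix m u := fun u => by
    rw [BayesNet.sampleSuffix, List.take_of_length_le (by simp)]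
  unfold pairDraw
  apply Simulates.of_le
  · apply Simulates.seq_pure
    · exact copyRow_simulates (k := 0) (k' := 0) hn (fun _ _ => rfl) (fun _ _ => rfl) rfl rfl
        (Or.inl (by decide))
    rintro s₁ ⟨hcopy, -⟩ hF₁
    have hI₁ := (SameInputs.refl s).trans_frame hF₁
    apply Simulates.seq
    · refine forwardRow_simulates (l := 0) (x := fun _ => false) (fun v => ?_) rfl
        (hI₁.level.trans hm) rfl (by decide) (by decide) (Nat.zero_le m) hmn
      rw [hcopy v v.2, hzero]
      rfl
    rintro u s₂ hu hF₂
    have hI₂ := hI₁.trans_frame hF₂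
    apply Simulates.seq_pure
    · exact copyRow_simulates (k := 0) (k' := 0) (hI₂.size.trans hn) (fun _ _ => rfl)
        (fun _ _ => rfl) rfl rfl (Or.inl (by decide))
    rintro s₃ ⟨hcopy, -⟩ hF₃
    have hI₃ := hI₂.trans_frame hF₃
    have hu₃ : RowHolds s₃ 3 0 u := hu.of_eq (hF₃.natArr 3 rfl)
    have hu₃' : RowHolds s₃ 4 0 u := fun v => (hcopy v v.2).trans (hu v)
    apply Simulates.seq
    · exact (forwardRow_simulates (lo := .var 4) hu₃ (hI₃.level.trans hm) (hI₃.size.trans hn) rfl (by decide)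
        (by decide) hmn le_rfl).law_eq (hsuffix u)
    rintro x s₄ hx hF₄
    have hI₄ := hI₃.trans_frame hF₄
    refine Simulates.law_eq (Simulates.seq
      (ν' := fun y => PMF.pure (f x * f y * B.basis S x * B.basis S y)) (T' := 80 * (n + 1) ^ 2 +
        (2 * n + 18))
      ((forwardRow_simulates (lo := .var 4) (hu₃'.of_eq (hF₄.natArr 4 rfl)) (hI₄.level.trans hm)
        (hI₄.size.trans hn) rfl (by decide) (by decide) hmn le_rfl).law_eq (hsuffix u)) ?_) rfl
    rintro y s₅ hy hF₅
    have hI₅ := hI₄.trans_frame hF₅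
    have hx₅ : RowHolds s₅ 3 0 x := hx.of_eq (hF₅.natArr 3 rfl)
    apply Simulates.of_le
    · apply Simulates.step_query
      apply Simulates.step_query
      apply Simulates.step_setReal
      apply Simulates.seq_pure
      · exact basisRow_simulates (S := S) (x := x) (hI₅.size.trans hn)
          (fun v => (congrArg₂ (fun g i => g i v) hI₅.stack hI₅.row).trans (hS v)) hx₅
      rintro s₆ h₆ hF₆
      have hI₆ := (((hI₅.setReal _ _).setReal _ _).setReal _ _).trans_frame hF₆
      apply Simulates.step_setReal
      apply Simulates.seq_pure
      · exact basisRow_simulates (S := S) (x := y) (hI₆.size.trans hn)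
          (fun v => (congrArg₂ (fun g i => g i v) hI₆.stack hI₆.row).trans (hS v))
          (hy.of_eq (hF₆.natArr 4 rfl))
      rintro s₇ h₇ hF₇
      refine Simulates.instr_setReal ?_
      rw [RamState.setReal_real, if_pos rfl]
      change s₇.real 9 * s₇.real 8 = _
      rw [h₇, hF₇.real 9 rfl]
      change s₆.real 9 * s₆.real 8 * _ = _
      rw [h₆, hF₆.real 9 rfl]
      change f (s₅.point n 3 0) * f (s₅.point n 4 0) * _ * _ = _
      rw [hx₅.point_eq, hy.point_eq]
    · simp only [NatExpr.cost, RealExpr.cost]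
      omega
  · nlinarith

theorem coeffDraw_simulates {S : Finset (Fin n)} (hn : s.nat 0 = n)
    (hS : RowHolds s 0 (s.nat 10) (setPoint S)) (hzero : ∀ j, s.natArr 5 0 j = 0) :
    Simulates B f coeffDraw s (B.coeffSample f S) (400 * (n + 1) ^ 2)
      fun z s' => s'.real 9 = z := by
  unfold coeffDraw
  apply Simulates.of_le
  · apply Simulates.seq_pure
    · exact copyRow_simulates (k := 0) (k' := 0) hn (fun _ _ => rfl) (fun _ _ => rfl) rfl rfl
        (Or.inl (by decide))
    rintro s₁ ⟨hcopy, -⟩ hF₁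
    have hI₁ := (SameInputs.refl s).trans_frame hF₁
    refine Simulates.law_eq (Simulates.seq (ν := B.samplePrefix n)
      (ν' := fun x => PMF.pure (f x * B.basis S x)) (T' := 40 * (n + 1) ^ 2 + (n + 6))
      (forwardRow_simulates (l := 0) (x := fun _ => false) (fun v => ?_) rfl
        (hI₁.size.trans hn) rfl (by decide) (by decide) (Nat.zero_le n) le_rfl) ?_) rfl
    · rw [hcopy v v.2, hzero]
      rfl
    rintro x s₂ hx hF₂
    have hI₂ := hI₁.trans_frame hF₂
    apply Simulates.of_le
    · apply Simulates.step_query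
      apply Simulates.seq_pure
      · exact basisRow_simulates (S := S) (x := x) (hI₂.size.trans hn)
          (fun v => (congrArg₂ (fun g i => g i v) hI₂.found hI₂.row).trans (hS v)) hx
      rintro s₃ h₃ hF₃
      refine Simulates.instr_setReal ?_
      rw [RamState.setReal_real, if_pos rfl]
      change s₃.real 9 * s₃.real 8 = _
      rw [h₃, hF₃.real 9 rfl]
      change f (s₂.point n 3 0) * _ = _
      rw [hx.point_eq]
    · simp only [NatExpr.cost, RealExpr.cost]
      omega
  · nlinarith

end Subprograms
end

noncomputable section

/-! ### The program for the search

The integer variable `3` is the height of the stack. Its sets are in the integer array `1`, its levels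
in column `0` of the integer array `2`. -/

local infixr:60 " ⨟ " => Program.seq

namespace Program

/-- The set in row `nat 10` of the stack is returned. -/
def acceptLeaf : Program :=
  copyRow 1 (.var 10) 0 (.var 2) ⨟ incr 2 ⨟ instr (.setNat 3 (.var 10))

/-- The top of the stack, in row `nat 10`, is replaced by its two children. -/
def acceptNode : Program :=
  copyRow 1 (.var 10) 1 (.var 3) ⨟
    instr (.setNatArr 1 (.var 10) (.sub (.var 4) (.const 1)) (.const 1)) ⨟
    instr (.setNatArr 2 (.var 10) (.const 0) (.sub (.var 4) (.const 1))) ⨟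
    instr (.setNatArr 2 (.var 3) (.const 0) (.sub (.var 4) (.const 1))) ⨟ incr 3

/-- One call of the search. -/
def searchCall : Program :=
  ite (.natEq (.var 3) (.const 0)) (instr .skip)
    (instr (.setNat 10 (.sub (.var 3) (.const 1))) ⨟
      instr (.setNat 4 (.arr 2 (.var 10) (.const 0))) ⨟ meanDraws pairDraw 4 ⨟
      ite (.realLe (.div (.mul (.var 0) (.var 0)) (.ofNat (.const 2))) (.var 6))
        (ite (.natEq (.var 4) (.const 0)) acceptLeaf acceptNode) (instr (.setNat 3 (.var 10))))

end Program

/-! ### Correctness and cost of one call. -/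

section Search

open Program

variable {n : ℕ} {B : BayesNet n} {f : Cube n → ℝ} {s : RamState}

/-- The memory holds the given stack, with its top first. -/
def StackHolds (s : RamState) : List (ℕ × Finset (Fin n)) → Prop
  | [] => True
  | (m, S) :: rest => (s.natArr 2 rest.length 0 = m ∧ m ≤ n ∧
      RowHolds s 1 rest.length (setPoint S)) ∧ StackHolds s rest

theorem StackHolds.congr {s' : RamState} {st : List (ℕ × Finset (Fin n))} (h : StackHolds s st)
    (h2 : ∀ i < st.length, s'.natArr 2 i 0 = s.natArr 2 i 0)
    (h1 : ∀ i < st.length, ∀ j < n, s'.natArr 1 i j = s.natArr 1 i j) : StackHolds s' st := by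
  induction st with
  | nil => trivial
  | cons p rest ih =>
    obtain ⟨⟨hm, hmn, hS⟩, hrest⟩ := h
    have hlt : rest.length < (p :: rest).length := by simp
    exact ⟨⟨(h2 _ hlt).trans hm, hmn, fun v => (h1 _ hlt v v.2).trans (hS v)⟩,
      ih hrest (fun i hi => h2 i (hi.trans hlt)) fun i hi => h1 i (hi.trans hlt)⟩

/-- The memory holds the stack and the list of sets found so far. -/
structure SearchHolds (s : RamState) (x : List (ℕ × Finset (Fin n)) × List (Finset (Fin n))) :
    Prop where
  height : s.nat 3 = x.1.length
  count : s.nat 2 = x.2.length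
  stack : StackHolds s x.1
  found : ∀ j (h : j < x.2.length), RowHolds s 0 j (setPoint x.2[j])

/-- The bound on the length of the list is carried along because the time bound has to hold on all
outcomes, including those with inaccurate estimates, where $4/\theta^2$ may be exceeded. -/
theorem acceptLeaf_simulates {S : Finset (Fin n)} {rest : List (ℕ × Finset (Fin n))}
    {acc : List (Finset (Fin n))} (hn : s.nat 0 = n) (h10 : s.nat 10 = rest.length)
    (h2 : s.nat 2 = acc.length) (hS : RowHolds s 1 rest.length (setPoint S))
    (hrest : StackHolds s rest)
    (hacc : ∀ j (h : j < acc.length), RowHolds s 0 j (setPoint acc[j])) :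
    Simulates B f acceptLeaf s (PMF.pure (rest, acc ++ [S])) (40 * (n + 1) ^ 2 + 6)
      fun y s' => SearchHolds s' y ∧ y.2.length ≤ acc.length + 1 := by
  unfold acceptLeaf incr
  refine Simulates.seq_pure (T' := 6)
    (copyRow_simulates (k := rest.length) (k' := acc.length) hn
      (fun s' h => (h 10 (by decide)).trans h10) (fun s' h => (h 2 (by decide)).trans h2) rfl rfl
      (Or.inl (by decide))) ?_
  rintro s₁ ⟨hcopy, hother⟩ hF
  refine Simulates.step_setNat (T := 2) (Simulates.instr_setNat ⟨⟨?_, ?_, ?_, ?_⟩, by simp⟩)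
  · exact (hF.nat 10 rfl).trans h10
  · refine (congrArg (· + 1) ((hF.nat 2 rfl).trans h2)).trans ?_
    simp
  · exact hrest.congr (fun i _ => congrFun₂ (hF.natArr 2 rfl) i 0) fun i _ j _ =>
      congrFun₂ (hF.natArr 1 rfl) i j
  · intro j hj v
    change s₁.natArr 0 j v = _
    by_cases hj' : j < acc.length
    · rw [hother j v hj'.ne, hacc j hj' v]
      simp [List.getElem_append_left, hj']
    · obtain rfl : j = acc.length := by
        simp only [List.length_append, List.length_singleton] at hj
        omega
      rw [hcopy v v.2, hS v]
      simp

/-- The unchanged copy of `S` goes on top of the stack and is treated first, as in the recursion.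
The old row becomes the second child by setting its bit at `m`. -/
theorem acceptNode_simulates {m : ℕ} {S : Finset (Fin n)} {rest : List (ℕ × Finset (Fin n))}
    {acc : List (Finset (Fin n))} (hn : s.nat 0 = n) (h10 : s.nat 10 = rest.length)
    (h3 : s.nat 3 = rest.length + 1) (h4 : s.nat 4 = m + 1) (hm : m + 1 ≤ n)
    (h2 : s.nat 2 = acc.length) (hS : RowHolds s 1 rest.length (setPoint S))
    (hrest : StackHolds s rest)
    (hacc : ∀ j (h : j < acc.length), RowHolds s 0 j (setPoint acc[j])) :
    Simulates B f acceptNode s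
      (PMF.pure ((m, S) :: (m, BayesNet.addIndex m S) :: rest, acc)) (40 * (n + 1) ^ 2 + 22)
      fun y s' => SearchHolds s' y ∧ y.2.length ≤ acc.length + 1 := by
  unfold acceptNode incr
  refine Simulates.seq_pure (T' := 22)
    (copyRow_simulates (k := rest.length) (k' := rest.length + 1) hn
      (fun s' h => (h 10 (by decide)).trans h10) (fun s' h => (h 3 (by decide)).trans h3) rfl rfl
      (Or.inr (by omega))) ?_
  rintro s₁ ⟨hcopy, hother⟩ hF
  have h10' : s₁.nat 10 = rest.length := (hF.nat 10 rfl).trans h10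
  have h3' : s₁.nat 3 = rest.length + 1 := (hF.nat 3 rfl).trans h3
  have h4' : s₁.nat 4 - 1 = m := by rw [hF.nat 4 rfl, h4]; rfl
  refine Simulates.step_setNatArr (T := 16) (Simulates.step_setNatArr (T := 10)
    (Simulates.step_setNatArr (T := 4) (Simulates.instr_setNat ?_)))
  have e1 : ∀ i j, (((s₁.setNatArr 1 (s₁.nat 10) (s₁.nat 4 - 1) 1).setNatArr 2 (s₁.nat 10) 0
      (s₁.nat 4 - 1)).setNatArr 2 (s₁.nat 3) 0 (s₁.nat 4 - 1)).natArr 1 i j =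
      if i = rest.length ∧ j = m then 1 else s₁.natArr 1 i j := by
    intro i j
    simp [RamState.setNatArr_natArr, h10', h4']
  have e2 : ∀ i, (((s₁.setNatArr 1 (s₁.nat 10) (s₁.nat 4 - 1) 1).setNatArr 2 (s₁.nat 10) 0
      (s₁.nat 4 - 1)).setNatArr 2 (s₁.nat 3) 0 (s₁.nat 4 - 1)).natArr 2 i 0 =
      if i = rest.length + 1 then m else if i = rest.length then m else s₁.natArr 2 i 0 := by
    intro i
    simp [RamState.setNatArr_natArr, h10', h4', h3']
  have hF2 : ∀ i, s₁.natArr 2 i 0 = s.natArr 2 i 0 := fun i => congrFun₂ (hF.natArr 2 rfl) i 0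
  refine ⟨⟨?_, (hF.nat 2 rfl).trans h2, ⟨⟨?_, by omega, fun v => ?_⟩,
    ⟨⟨?_, by omega, fun v => ?_⟩, ?_⟩⟩, ?_⟩, by simp⟩
  · exact congrArg (· + 1) h3'
  · refine (e2 _).trans ?_
    simp
  · refine (e1 _ _).trans ?_
    simp only [List.length_cons]
    rw [if_neg (by omega), hcopy v v.2, hS v]
  · refine (e2 _).trans ?_
    simp
  · refine (e1 _ _).trans ?_
    rw [BayesNet.addIndex_of_lt hm]
    by_cases hv : (v : ℕ) = m
    · rw [if_pos ⟨rfl, hv⟩, show v = ⟨m, hm⟩ from Fin.ext hv]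
      simp [setPoint]
    · have hv' : v ≠ ⟨m, hm⟩ := fun h => hv (congrArg Fin.val h)
      rw [if_neg fun h => hv h.2, hother _ _ (by omega), hS v]
      simp [setPoint, hv']
  · refine hrest.congr (fun i hi => (e2 i).trans ?_) fun i hi j _ => (e1 i j).trans ?_
    · rw [if_neg (by omega), if_neg (by omega), hF2]
    · rw [if_neg (by omega), hother _ _ (by omega)]
  · intro j hj
    exact (hacc j hj).of_eq (hF.natArr 0 rfl)

/-- A call on an empty stack does nothing, in agreement with `stackStep`; the loop around it can
therefore make a fixed number of passes. -/
theorem searchCall_simulates {x : List (ℕ × Finset (Fin n)) × List (Finset (Fin n))}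
    (hn : s.nat 0 = n) (hzero : ∀ j, s.natArr 5 0 j = 0) (hb : 0 ≤ s.real 4)
    (hx : SearchHolds s x) :
    Simulates B f searchCall s (B.stackStep f (s.real 0) (⌊s.real 4⌋₊ + 1) x)
      ((⌊s.real 4⌋₊ + 1) * (412 * (n + 1) ^ 2) + 100 * (n + 1) ^ 2)
      fun y s' => SearchHolds s' y ∧ y.2.length ≤ x.2.length + 1 := by
  have hq : 1 ≤ (n + 1) ^ 2 := Nat.one_le_pow _ _ (by omega)
  unfold searchCall
  obtain ⟨st, acc⟩ := x
  obtain ⟨h3, h2, hst, hacc⟩ := hx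
  match st with
  | [] =>
    refine Simulates.of_le (Simulates.ite_true h3 (Simulates.instr (by rfl) ?_)) ?_
    · exact ⟨⟨h3, h2, hst, hacc⟩, by simp⟩
    · simp only [TestExpr.cost, NatExpr.cost, Instr.cost]
      nlinarith
  | (m, S) :: rest =>
    obtain ⟨⟨hm, hmn, hS⟩, hrest⟩ := hst
    have h10 : s.nat 3 - 1 = rest.length := by rw [h3]; rfl
    apply Simulates.of_le
    · apply Simulates.ite_false
      · simp [TestExpr.Holds, NatExpr.eval, h3]
      apply Simulates.step_setNat
      apply Simulates.step_setNat
      set s₁ := (s.setNat 10 ((NatExpr.sub (.var 3) (.const 1)).eval s)).setNat 4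
        ((NatExpr.arr 2 (.var 10) (.const 0)).eval
          (s.setNat 10 ((NatExpr.sub (.var 3) (.const 1)).eval s))) with hs₁
      have h10' : s₁.nat 10 = rest.length := h10
      have h4 : s₁.nat 4 = m := by
        change s.natArr 2 (s.nat 3 - 1) 0 = m
        rw [h10, hm]
      have hmean : Simulates B f (meanDraws pairDraw 4) s₁
          (empiricalMean (B.pairSample f m S) (⌊s.real 4⌋₊ + 1))
          ((⌊s.real 4⌋₊ + 1) * (400 * (n + 1) ^ 2 + 12) + 14) fun G s' => s'.real 6 = G :=
        meanDraws_simulates (s := s₁) hb (by decide) rfl rfl rfl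
        fun s' hF => by
          have h10'' : s'.nat 10 = rest.length := (hF.nat 10 rfl).trans h10'
          refine pairDraw_simulates ((hF.nat 0 rfl).trans hn) ((hF.nat 4 rfl).trans h4) hmn ?_ ?_
          · rw [h10'']
            exact RowHolds.of_eq (s := s) hS (hF.natArr 1 rfl)
          · intro j
            exact (congrFun₂ (hF.natArr 5 rfl) 0 j).trans (hzero j)
      refine Simulates.law_eq (Simulates.seq (T' := 40 * (n + 1) ^ 2 + 35) (ν' := fun G =>
        PMF.pure (if s.real 0 ^ 2 / 2 ≤ G then BayesNet.expand m S rest acc else (rest, acc)))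
        hmean ?_) rfl
      rintro G s₂ hG hF
      have e0 : s₂.nat 0 = n := (hF.nat 0 rfl).trans hn
      have e2 : s₂.nat 2 = acc.length := (hF.nat 2 rfl).trans h2
      have e3 : s₂.nat 3 = rest.length + 1 := (hF.nat 3 rfl).trans h3
      have e4 : s₂.nat 4 = m := (hF.nat 4 rfl).trans h4
      have e10 : s₂.nat 10 = rest.length := (hF.nat 10 rfl).trans h10'
      have er : s₂.real 0 = s.real 0 := hF.real 0 rfl
      have eS : RowHolds s₂ 1 rest.length (setPoint S) :=
        RowHolds.of_eq (s := s) hS (hF.natArr 1 rfl)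
      have erest : StackHolds s₂ rest := hrest.congr
        (fun i _ => congrFun₂ (hF.natArr 2 rfl) i 0) fun i _ j _ => congrFun₂ (hF.natArr 1 rfl) i j
      have eacc : ∀ j (h : j < acc.length), RowHolds s₂ 0 j (setPoint acc[j]) := fun j hj =>
        RowHolds.of_eq (s := s) (hacc j hj) (hF.natArr 0 rfl)
      have htest : (TestExpr.realLe (.div (.mul (.var 0) (.var 0)) (.ofNat (.const 2)))
          (.var 6)).Holds s₂ ↔ s.real 0 ^ 2 / 2 ≤ G := by
        simp only [TestExpr.Holds, RealExpr.eval, NatExpr.eval, er, hG, sq, Nat.cast_ofNat]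
      by_cases hGθ : s.real 0 ^ 2 / 2 ≤ G
      · rw [if_pos hGθ]
        refine Simulates.of_le (Simulates.ite_true (T := 40 * (n + 1) ^ 2 + 27) (htest.2 hGθ) ?_) ?_
        · match m with
          | 0 =>
            refine Simulates.of_le (Simulates.ite_true (b := .natEq (.var 4) (.const 0)) e4
              (acceptLeaf_simulates e0 e10 e2 eS erest eacc)) ?_
            simp only [TestExpr.cost, NatExpr.cost]
            omega
          | m + 1 =>
            refine Simulates.of_le (Simulates.ite_false (b := .natEq (.var 4) (.const 0)) ?_
              (acceptNode_simulates e0 e10 e3 e4 hmn e2 eS erest eacc)) ?_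
            · simp [TestExpr.Holds, NatExpr.eval, e4]
            · simp only [TestExpr.cost, NatExpr.cost]
              omega
        · simp only [TestExpr.cost, RealExpr.cost, NatExpr.cost]
          omega
      · rw [if_neg hGθ]
        refine Simulates.of_le (Simulates.ite_false (fun h => hGθ (htest.1 h))
          (Simulates.instr_setNat ⟨⟨e10, e2, erest.congr (fun _ _ => rfl) fun _ _ _ _ => rfl, eacc⟩,
            by simp⟩)) ?_
        simp only [TestExpr.cost, RealExpr.cost, NatExpr.cost]
        omega
    · simp only [TestExpr.cost, NatExpr.cost]
      nlinarith

end Search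
end

noncomputable section

/-! ### The complete program -/

local infixr:60 " ⨟ " => Program.seq

namespace Program

def estimateLoopBody : Program :=
  meanDraws coeffDraw 5 ⨟ instr (.setRealArr 0 (.var 10) (.const 0) (.var 6)) ⨟ incr 10

/-- Estimates the coefficients of all the sets found. -/
def estimateLoop : Program :=
  instr (.setNat 10 (.const 0)) ⨟ loop (.natLt (.var 10) (.var 2)) estimateLoopBody

def searchLoopBody : Program := searchCall ⨟ incr 5

/-- The search, with as many calls as there are natural numbers up to the real variable `3`. -/
def searchLoop : Program := loop (.realLe (.ofNat (.var 5)) (.var 3)) searchLoopBody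

/-- The extended KM algorithm, aborted if the search is not finished within its number of calls. -/
def extendedKM : Program :=
  instr (.setReal 3 (.add (.ofNat (.const 1)) (.div (.mul (.ofNat (.const 8)) (.ofNat (.var 0)))
    (.mul (.var 0) (.var 0))))) ⨟
  instr (.setReal 4 (.div (.mul (.ofNat (.const 32)) (.var 3))
    (.mul (.mul (.mul (.var 0) (.var 0)) (.mul (.var 0) (.var 0))) (.var 2)))) ⨟
  instr (.setReal 5 (.div (.ofNat (.const 8))
    (.mul (.mul (.mul (.var 0) (.var 0)) (.mul (.var 1) (.var 1))) (.var 2)))) ⨟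
  instr (.setNatArr 2 (.const 0) (.const 0) (.var 0)) ⨟ instr (.setNat 3 (.const 1)) ⨟
  searchLoop ⨟
  ite (.natEq (.var 3) (.const 0)) (estimateLoop ⨟ instr (.setNat 1 (.const 1))) (instr .skip)

end Program

/-! ### Correctness and cost of the complete program. -/

section Main

open Program

variable {n : ℕ} {B : BayesNet n} {f : Cube n → ℝ} {s : RamState}

/-- `estimate` recurses on the head of the list, while the program appends; the accumulator `r`
holds the estimates already written. -/
theorem estimate_eq_iterSteps (m₂ : ℕ) (l : List (Finset (Fin n))) (i : ℕ)
    (r : List (Finset (Fin n) × ℝ)) :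
    iterSteps (fun i r => if h : i < l.length then
      (empiricalMean (B.coeffSample f l[i]) m₂).map fun c => r ++ [(l[i], c)] else PMF.pure r)
        i (l.length - i) r = (B.estimate f m₂ (l.drop i)).map (r ++ ·) := by
  induction hk : l.length - i generalizing i r with
  | zero =>
    rw [List.drop_eq_nil_of_le (by omega), BayesNet.estimate, PMF.pure_map, List.append_nil]
    rfl
  | succ k ih =>
    have hi : i < l.length := by omega
    rw [List.drop_eq_getElem_cons hi, BayesNet.estimate, iterSteps, dif_pos hi, PMF.bind_map,
      PMF.map_bind]
    refine congrArg _ (funext fun c => ?_)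
    rw [Function.comp_apply, ih (i + 1) _ (by omega), PMF.map_comp]
    refine congrArg (fun g => PMF.map g _) (funext fun r' => ?_)
    simp

theorem output_eq_some {r : List (Finset (Fin n) × ℝ)} (h1 : s.nat 1 ≠ 0)
    (h2 : s.nat 2 = r.length) (hS : ∀ j (h : j < r.length), RowHolds s 0 j (setPoint r[j].1))
    (hc : ∀ j (h : j < r.length), s.realArr 0 j 0 = r[j].2) : s.output n = some r := by
  rw [RamState.output, if_neg h1]
  refine congrArg some (List.ext_getElem (by simp [h2]) fun j h h' => ?_)
  rw [List.getElem_map, List.getElem_range, (hS j h').point_eq, hc j h']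
  refine Prod.ext ?_ rfl
  ext v
  simp [setPoint]

theorem estimateLoop_simulates {l : List (Finset (Fin n))} (hn : s.nat 0 = n)
    (hzero : ∀ j, s.natArr 5 0 j = 0) (hb : 0 ≤ s.real 5) (h2 : s.nat 2 = l.length)
    (hl : ∀ j (h : j < l.length), RowHolds s 0 j (setPoint l[j])) :
    Simulates B f estimateLoop s (B.estimate f (⌊s.real 5⌋₊ + 1) l)
      (l.length * ((⌊s.real 5⌋₊ + 1) * (412 * (n + 1) ^ 2) + 25) + 5) fun r s' =>
        r.map Prod.fst = l ∧ ∀ j (h : j < r.length), s'.realArr 0 j 0 = r[j].2 := by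
  have hq : 1 ≤ (n + 1) ^ 2 := Nat.one_le_pow _ _ (by omega)
  unfold estimateLoop
  apply Simulates.of_le
  · apply Simulates.step_setNat
    refine Simulates.mono ((Simulates.loop (N := l.length) (a := [])
      (T := (⌊s.real 5⌋₊ + 1) * (400 * (n + 1) ^ 2 + 12) + 22)
      (step := fun i r => if h : i < l.length then
        (empiricalMean (B.coeffSample f l[i]) (⌊s.real 5⌋₊ + 1)).map fun c => r ++ [(l[i], c)]
          else PMF.pure r)
      (Inv := fun i r s' => s'.nat 10 = i ∧ r.length = i ∧ r.map Prod.fst = l.take i ∧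
        ∀ j (h : j < r.length), s'.realArr 0 j 0 = r[j].2) ?_ ?_ ?_).law_eq ?_) ?_
    · exact ⟨rfl, rfl, rfl, fun j h => absurd h (Nat.not_lt_zero j)⟩
    · rintro i r s' hi ⟨h10, hlen, hr, hc⟩ hF
      have e0 : s'.nat 0 = n := (hF.nat 0 rfl).trans hn
      have e2 : s'.nat 2 = l.length := (hF.nat 2 rfl).trans h2
      have e5 : s'.real 5 = s.real 5 := hF.real 5 rfl
      have eS : RowHolds s' 0 i (setPoint l[i]) :=
        RowHolds.of_eq (s := s) (hl i hi) (hF.natArr 0 rfl)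
      have ez : ∀ j, s'.natArr 5 0 j = 0 := fun j =>
        (congrFun₂ (hF.natArr 5 rfl) 0 j).trans (hzero j)
      refine ⟨?_, ?_⟩
      · simp only [TestExpr.Holds, NatExpr.eval, h10, e2]
        exact hi
      · rw [dif_pos hi]
        have hmean : Simulates B f (meanDraws coeffDraw 5) s'
            (empiricalMean (B.coeffSample f l[i]) (⌊s'.real 5⌋₊ + 1))
            ((⌊s'.real 5⌋₊ + 1) * (400 * (n + 1) ^ 2 + 12) + 14) fun G s' => s'.real 6 = G :=
          meanDraws_simulates (e5 ▸ hb) (by decide) rfl rfl rfl fun s'' hF' => by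
            refine coeffDraw_simulates ((hF'.nat 0 rfl).trans e0) ?_ fun j =>
              (congrFun₂ (hF'.natArr 5 rfl) 0 j).trans (ez j)
            rw [(hF'.nat 10 rfl).trans h10]
            exact eS.of_eq (hF'.natArr 0 rfl)
        rw [e5] at hmean
        refine Simulates.law_eq (Simulates.seq (T' := 8) (ν' := fun c =>
          PMF.pure (r ++ [(l[i], c)])) hmean ?_) rfl
        rintro c s'' hG hF'
        have h10' : s''.nat 10 = i := (hF'.nat 10 rfl).trans h10
        refine Simulates.step_setRealArr (T := 4) (Simulates.instr_setNat ⟨?_, ?_, ?_, ?_⟩)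
        · exact congrArg (· + 1) h10'
        · simp [hlen]
        · rw [List.map_append, hr, List.take_succ_eq_append_getElem hi]
          rfl
        · intro j hj
          have key : ((s''.setRealArr 0 (s''.nat 10) 0 (s''.real 6)).realArr 0 j 0 : ℝ) =
              if j = i then c else s''.realArr 0 j 0 := by
            simp [RamState.setRealArr, h10', hG]
          refine key.trans ?_
          by_cases hji : j = i
          · rw [if_pos hji, List.getElem_append_right (by omega)]
            simp
          · have hj' : j < r.length := by simp at hj; omega
            rw [if_neg hji, List.getElem_append_left hj', hF'.realArr 0 rfl, hc j hj']
    · rintro r s' ⟨h10, -⟩ hF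
      have e2 : s'.nat 2 = l.length := (hF.nat 2 rfl).trans h2
      simp [TestExpr.Holds, NatExpr.eval, h10, e2]
    · refine (estimate_eq_iterSteps _ l 0 []).trans ?_
      rw [List.drop_zero]
      exact PMF.map_id _
    · rintro r s' ⟨-, -, hr, hc⟩ -
      exact ⟨by rw [hr, List.take_length], hc⟩
  · simp only [TestExpr.cost, NatExpr.cost]
    have : (⌊s.real 5⌋₊ + 1) * (400 * (n + 1) ^ 2 + 12) ≤
        (⌊s.real 5⌋₊ + 1) * (412 * (n + 1) ^ 2) := Nat.mul_le_mul_left _ (by omega)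
    have := Nat.mul_le_mul_left l.length this
    nlinarith

theorem searchLoop_simulates {x : List (ℕ × Finset (Fin n)) × List (Finset (Fin n))}
    (hn : s.nat 0 = n) (hzero : ∀ j, s.natArr 5 0 j = 0) (hK : 0 ≤ s.real 3) (hb : 0 ≤ s.real 4)
    (h5 : s.nat 5 = 0) (hx : SearchHolds s x) (hx2 : x.2 = []) :
    Simulates B f searchLoop s
      (iterSteps (fun _ => B.stackStep f (s.real 0) (⌊s.real 4⌋₊ + 1)) 0 (⌊s.real 3⌋₊ + 1) x)
      ((⌊s.real 3⌋₊ + 1) *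
        ((⌊s.real 4⌋₊ + 1) * (412 * (n + 1) ^ 2) + 100 * (n + 1) ^ 2 + 8) + 4)
      fun y s' => SearchHolds s' y ∧ y.2.length ≤ ⌊s.real 3⌋₊ + 1 := by
  unfold searchLoop
  refine Simulates.mono (Simulates.of_le (Simulates.loop (N := ⌊s.real 3⌋₊ + 1)
    (T := (⌊s.real 4⌋₊ + 1) * (412 * (n + 1) ^ 2) + 100 * (n + 1) ^ 2 + 4)
    (Inv := fun i y s' => s'.nat 5 = i ∧ SearchHolds s' y ∧ y.2.length ≤ i) ?_ ?_ ?_) ?_)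
    fun y s' h _ => h.2
  · exact ⟨h5, hx, by simp [hx2]⟩
  · rintro i y s' hi ⟨h5', hy, hlen⟩ hF
    have e0 : s'.nat 0 = n := (hF.nat 0 rfl).trans hn
    have er0 : s'.real 0 = s.real 0 := hF.real 0 rfl
    have er4 : s'.real 4 = s.real 4 := hF.real 4 rfl
    have ez : ∀ j, s'.natArr 5 0 j = 0 := fun j =>
      (congrFun₂ (hF.natArr 5 rfl) 0 j).trans (hzero j)
    refine ⟨?_, ?_⟩
    · simp only [TestExpr.Holds, RealExpr.eval, NatExpr.eval, h5', hF.real 3 rfl]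
      exact (Nat.le_floor_iff hK).1 (Nat.lt_succ_iff.1 hi)
    · have hcall := searchCall_simulates (B := B) (f := f) e0 ez (er4 ▸ hb) hy
      rw [er0, er4] at hcall
      refine Simulates.law_eq (Simulates.seq (T' := 4) (ν' := PMF.pure) hcall ?_) (PMF.bind_pure _)
      rintro z s'' ⟨hz, hzlen⟩ hF'
      refine Simulates.instr_setNat ⟨?_, ?_, by omega⟩
      · exact congrArg (· + 1) ((hF'.nat 5 rfl).trans h5')
      · exact ⟨hz.height, hz.count, hz.stack.congr (fun _ _ => rfl) fun _ _ _ _ => rfl, hz.found⟩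
  · rintro y s' ⟨h5', -⟩ hF
    simp only [TestExpr.Holds, RealExpr.eval, NatExpr.eval, h5', hF.real 3 rfl]
    rw [not_le, Nat.cast_add, Nat.cast_one]
    exact Nat.lt_floor_add_one _
  · simp only [TestExpr.cost, RealExpr.cost, NatExpr.cost]
    apply le_of_eq
    ring

open BayesNet in
theorem extendedKM_simulates {θ γ δ : ℝ} (hθ : 0 < θ) (hγ : 0 < γ) (hδ : 0 < δ) :
    Simulates B f Program.extendedKM (RamState.init n θ γ δ)
      (B.boundedKM f θ (⌊searchBudget n θ δ⌋₊ + 1) (⌊coeffBudget θ γ δ⌋₊ + 1)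
        (⌊callBudget n θ⌋₊ + 1))
      (1000 * (n + 1) ^ 2 * (⌊callBudget n θ⌋₊ + 1) *
        ((⌊searchBudget n θ δ⌋₊ + 1) + (⌊coeffBudget θ γ δ⌋₊ + 1)))
      fun o s' => s'.output n = o := by
  have hq : 1 ≤ (n + 1) ^ 2 := Nat.one_le_pow _ _ (by omega)
  unfold Program.extendedKM
  apply Simulates.of_le
  · apply Simulates.step_setReal
    apply Simulates.step_setReal
    apply Simulates.step_setReal
    apply Simulates.step_setNatArr
    apply Simulates.step_setNat
    -- From here on only the values of the initialized memory matter, not the way it was built.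
    generalize hs₀ : RamState.setNat _ _ _ = s₀
    have e0 : s₀.nat 0 = n := by rw [← hs₀]; rfl
    have e1 : s₀.nat 1 = 0 := by rw [← hs₀]; rfl
    have e2 : s₀.nat 2 = 0 := by rw [← hs₀]; rfl
    have e3 : s₀.nat 3 = 1 := by rw [← hs₀]; rfl
    have e5 : s₀.nat 5 = 0 := by rw [← hs₀]; rfl
    have r0 : s₀.real 0 = θ := by rw [← hs₀]; rfl
    have r3 : s₀.real 3 = callBudget n θ := by
      rw [← hs₀]
      change ((1 : ℕ) : ℝ) + ((8 : ℕ) : ℝ) * (n : ℝ) / (θ * θ) = _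
      rw [callBudget, sq]; norm_num
    have r4 : s₀.real 4 = searchBudget n θ δ := by
      rw [← hs₀]
      change ((32 : ℕ) : ℝ) * (((1 : ℕ) : ℝ) + ((8 : ℕ) : ℝ) * (n : ℝ) / (θ * θ)) /
        (θ * θ * (θ * θ) * δ) = _
      rw [searchBudget, callBudget, sq, show θ ^ 4 = θ * θ * (θ * θ) by ring]; norm_num
    have r5 : s₀.real 5 = coeffBudget θ γ δ := by
      rw [← hs₀]
      change ((8 : ℕ) : ℝ) / (θ * θ * (γ * γ) * δ) = _
      rw [coeffBudget, sq, sq]; norm_num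
    have a2 : s₀.natArr 2 0 0 = n := by rw [← hs₀]; rfl
    have a1 : ∀ j, s₀.natArr 1 0 j = 0 := fun j => by rw [← hs₀]; rfl
    have a5 : ∀ j, s₀.natArr 5 0 j = 0 := fun j => by rw [← hs₀]; rfl
    clear hs₀
    have hK : 0 ≤ callBudget n θ := by unfold callBudget; positivity
    have hb1 : 0 ≤ searchBudget n θ δ := by unfold searchBudget; positivity
    have hb2 : 0 ≤ coeffBudget θ γ δ := by unfold coeffBudget; positivity
    have hloop := searchLoop_simulates (B := B) (f := f) (s := s₀) (x := ([(n, ∅)], [])) e0 a5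
      (r3 ▸ hK) (r4 ▸ hb1) e5
      ⟨e3, e2, ⟨⟨a2, le_rfl, fun v => (a1 v).trans (by simp [setPoint])⟩, trivial⟩,
        fun j h => absurd h (Nat.not_lt_zero j)⟩ rfl
    rw [r0, r3, r4] at hloop
    -- Each call finds at most one set, so the number of calls also bounds the number of
    -- coefficients to be estimated.
    refine Simulates.seq (T' := (⌊callBudget n θ⌋₊ + 1) *
      ((⌊coeffBudget θ γ δ⌋₊ + 1) * (412 * (n + 1) ^ 2) + 25) + 10) hloop ?_
    rintro ⟨st, l⟩ s₁ ⟨⟨h3, h2, hst, hl⟩, hlen⟩ hF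
    have e1' : s₁.nat 1 = 0 := (hF.nat 1 rfl).trans e1
    have r5' : s₁.real 5 = coeffBudget θ γ δ := (hF.real 5 rfl).trans r5
    by_cases hnil : st = []
    · subst hnil
      dsimp only at h2 hl hlen
      rw [if_pos rfl]
      have hest := estimateLoop_simulates (B := B) (f := f) (s := s₁) ((hF.nat 0 rfl).trans e0)
        (fun j => (congrFun₂ (hF.natArr 5 rfl) 0 j).trans (a5 j)) (r5' ▸ hb2) h2 hl
      rw [r5'] at hest
      refine Simulates.of_le (Simulates.ite_true (b := .natEq (.var 3) (.const 0)) h3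
        (Simulates.law_eq (Simulates.seq (T' := 2) (ν' := fun r => PMF.pure (some r)) hest ?_)
          rfl)) ?_
      · rintro r s₂ ⟨hr, hc⟩ hF'
        have hlr : r.length = l.length := by rw [← hr, List.length_map]
        refine Simulates.instr_setNat (output_eq_some ?_ ?_ ?_ ?_)
        · exact one_ne_zero
        · exact ((hF'.nat 2 rfl).trans h2).trans hlr.symm
        · intro j hj
          have hj' : j < l.length := hlr ▸ hj
          have : r[j].1 = l[j] := by simp only [← hr, List.getElem_map]
          rw [this]
          exact RowHolds.of_eq (s := s₁) (hl j hj') (hF'.natArr 0 rfl)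
        · exact hc
      · simp only [TestExpr.cost, NatExpr.cost]
        have := Nat.mul_le_mul_right
          ((⌊coeffBudget θ γ δ⌋₊ + 1) * (412 * (n + 1) ^ 2) + 25) hlen
        omega
    · rw [if_neg hnil]
      refine Simulates.of_le (Simulates.ite_false (b := .natEq (.var 3) (.const 0)) ?_
        (Simulates.instr (by rfl) (by rw [RamState.output, if_pos e1']))) ?_
      · change ¬ (s₁.nat 3 = 0)
        rw [h3]
        simpa using hnil
      · simp only [TestExpr.cost, NatExpr.cost, Instr.cost]
        omega
  · simp only [RealExpr.cost, NatExpr.cost]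
    generalize ⌊callBudget n θ⌋₊ = K
    generalize ⌊searchBudget n θ δ⌋₊ = M
    generalize ⌊coeffBudget θ γ δ⌋₊ = N
    generalize (n + 1) ^ 2 = q at hq
    obtain ⟨q, rfl⟩ := Nat.exists_eq_add_of_le hq
    nlinarith [Nat.zero_le (q * K * M), Nat.zero_le (q * K * N), Nat.zero_le (q * K),
      Nat.zero_le (K * M), Nat.zero_le (K * N), Nat.zero_le (q * M), Nat.zero_le (q * N)]

/-- The law of the output of a simulating program. -/
theorem Simulates.exists_exec {P : Program} {T : ℕ} {A : Type} {ν : PMF A} {out : RamState → A}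
    (h : Simulates B f P s ν T fun a s' => out s' = a) :
    ∃ μ : PMF (RamState × ℕ), Exec B f P s μ ∧ (∀ r ∈ μ.support, r.2 ≤ T) ∧
      μ.map (fun r => out r.1) = ν := by
  obtain ⟨κ, hκ, hν, hR⟩ := h
  refine ⟨κ.map Prod.snd, hκ, fun r hr => ?_, ?_⟩
  · rw [PMF.support_map] at hr
    obtain ⟨p, hp, rfl⟩ := hr
    exact (hR p hp).2
  · rw [PMF.map_comp, ← hν]
    exact PMF.map_congr_support fun p hp => (hR p hp).1

end Main

/-! ### Polynomial bounds -/

section Bounds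

open BayesNet

variable {n : ℕ} {θ γ δ : ℝ}

theorem callBudget_le {W : ℝ} (hθ : 0 < θ) (hW : 1 ≤ W) (hn : n ≤ W) (hθW : 1 / θ ≤ W) :
    callBudget n θ ≤ 9 * W ^ 3 := by
  have h : callBudget n θ = 1 + 8 * (n * (1 / θ) ^ 2) := by rw [callBudget]; field_simp
  have h1 : (n : ℝ) * (1 / θ) ^ 2 ≤ W * W ^ 2 := by gcongr
  have h2 : 1 ≤ W ^ 3 := one_le_pow₀ hW
  rw [h]
  linarith [show W * W ^ 2 = W ^ 3 by ring]

theorem searchBudget_le {W : ℝ} (hθ : 0 < θ) (hδ : 0 < δ) (hW : 1 ≤ W) (hn : n ≤ W)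
    (hθW : 1 / θ ≤ W) (hδW : 1 / δ ≤ W) : searchBudget n θ δ ≤ 288 * W ^ 8 := by
  have h : searchBudget n θ δ = 32 * (callBudget n θ * (1 / θ) ^ 4 * (1 / δ)) := by
    rw [searchBudget]; field_simp
  have h1 : callBudget n θ * (1 / θ) ^ 4 * (1 / δ) ≤ 9 * W ^ 3 * W ^ 4 * W := by
    gcongr
    exact callBudget_le hθ hW hn hθW
  rw [h]
  linarith [show 9 * W ^ 3 * W ^ 4 * W = 9 * W ^ 8 by ring]

theorem coeffBudget_le {W : ℝ} (hθ : 0 < θ) (hγ : 0 < γ) (hδ : 0 < δ) (hW : 1 ≤ W)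
    (hθW : 1 / θ ≤ W) (hγW : 1 / γ ≤ W) (hδW : 1 / δ ≤ W) : coeffBudget θ γ δ ≤ 8 * W ^ 8 := by
  have h : coeffBudget θ γ δ = 8 * ((1 / θ) ^ 2 * (1 / γ) ^ 2 * (1 / δ)) := by
    rw [coeffBudget]; field_simp
  have h1 : (1 / θ) ^ 2 * (1 / γ) ^ 2 * (1 / δ) ≤ W ^ 2 * W ^ 2 * W := by gcongr
  have h2 : W ^ 5 ≤ W ^ 8 := pow_le_pow_right₀ hW (by norm_num)
  rw [h]
  linarith [show W ^ 2 * W ^ 2 * W = W ^ 5 by ring]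

end Bounds
end

theorem mainTheorem3 :
    ∃ (P : Program) (m₁ m₂ : ℕ → ℝ → ℝ → ℝ → ℕ) (C d : ℕ),
      ∀ (n : ℕ) (B : BayesNet n) (f : Cube n → ℝ), (∀ x, |f x| ≤ 1) →
      ∀ θ γ δ : ℝ, 0 < θ → 0 < γ → 0 < δ →
        (m₁ n θ γ δ : ℝ) ≤ C * (1 + n + 1 / θ + 1 / γ + 1 / δ) ^ d ∧
        (m₂ n θ γ δ : ℝ) ≤ C * (1 + n + 1 / θ + 1 / γ + 1 / δ) ^ d ∧
        ENNReal.ofReal (1 - δ) ≤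
          (B.extendedKM f θ (m₁ n θ γ δ) (m₂ n θ γ δ)).toOuterMeasure
            {l | ∃ h, B.IsGoodOutput f θ γ l h} ∧
        ∃ μ : PMF (RamState × ℕ),
          Exec B f P (RamState.init n θ γ δ) μ ∧
          (∀ r ∈ μ.support, (r.2 : ℝ) ≤ C * (1 + n + 1 / θ + 1 / γ + 1 / δ) ^ d) ∧
          (∀ l, μ.toOuterMeasure {r | r.1.output n = some l} ≤
            B.extendedKM f θ (m₁ n θ γ δ) (m₂ n θ γ δ) l) ∧
          ENNReal.ofReal (1 - δ) ≤
            μ.toOuterMeasure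
              {r | ∃ l h, r.1.output n = some l ∧ B.IsGoodOutput f θ γ l h} := by
  -- The exponent is $13=2+3+8$, from $(n+1)^2$, the number of calls and the number of samples. The
  -- constant exceeds $1000\cdot10\cdot(289+9)=2980000$.
  refine ⟨Program.extendedKM, fun n θ _ δ => ⌊BayesNet.searchBudget n θ δ⌋₊ + 1,
    fun _ θ γ δ => ⌊BayesNet.coeffBudget θ γ δ⌋₊ + 1, 3000000, 13, ?_⟩
  intro n B f hf θ γ δ hθ hγ hδ
  obtain ⟨μ, hexec, hsteps, hlaw⟩ := (extendedKM_simulates (B := B) (f := f) hθ hγ hδ).exists_exec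
  -- Events about the output of the machine have the probabilities that `boundedKM` gives them; the
  -- remaining claims on `μ` other than the running time reduce to this.
  have hout : ∀ A : Set (Option (List (Finset (Fin n) × ℝ))),
      μ.toOuterMeasure {r | r.1.output n ∈ A} =
        (B.boundedKM f θ (⌊BayesNet.searchBudget n θ δ⌋₊ + 1) (⌊BayesNet.coeffBudget θ γ δ⌋₊ + 1)
          (⌊BayesNet.callBudget n θ⌋₊ + 1)).toOuterMeasure A := fun A => by
    rw [← hlaw, PMF.toOuterMeasure_map_apply]
    rfl
  have hgood := PMF.ofReal_one_sub_le_toOuterMeasure hδ.le (B.boundedKM_failure_le f hf hθ hγ hδ)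
  generalize hWdef : 1 + (n : ℝ) + 1 / θ + 1 / γ + 1 / δ = W
  have hθ' : 0 < 1 / θ := by positivity
  have hγ' : 0 < 1 / γ := by positivity
  have hδ' : 0 < 1 / δ := by positivity
  have hn' : (0 : ℝ) ≤ n := Nat.cast_nonneg n
  have hW : 1 ≤ W := by linarith
  have hnW : (n : ℝ) + 1 ≤ W := by linarith
  have hθW : 1 / θ ≤ W := by linarith
  have hγW : 1 / γ ≤ W := by linarith
  have hδW : 1 / δ ≤ W := by linarith
  have hpow : ∀ k : ℕ, 1 ≤ W ^ k := fun k => one_le_pow₀ hW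
  have hfloor : ∀ {b c : ℝ} (k : ℕ), 0 ≤ b → b ≤ c * W ^ k →
      ((⌊b⌋₊ + 1 : ℕ) : ℝ) ≤ (c + 1) * W ^ k := by
    intro b c k hb hbc
    push_cast
    linarith [Nat.floor_le hb, hpow k]
  have hK : ((⌊BayesNet.callBudget n θ⌋₊ + 1 : ℕ) : ℝ) ≤ (9 + 1) * W ^ 3 :=
    hfloor 3 (by unfold BayesNet.callBudget; positivity)
      (callBudget_le hθ hW (by linarith) hθW)
  have hM : ((⌊BayesNet.searchBudget n θ δ⌋₊ + 1 : ℕ) : ℝ) ≤ (288 + 1) * W ^ 8 :=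
    hfloor 8 (by unfold BayesNet.searchBudget BayesNet.callBudget; positivity)
      (searchBudget_le hθ hδ hW (by linarith) hθW hδW)
  have hN : ((⌊BayesNet.coeffBudget θ γ δ⌋₊ + 1 : ℕ) : ℝ) ≤ (8 + 1) * W ^ 8 :=
    hfloor 8 (by unfold BayesNet.coeffBudget; positivity)
      (coeffBudget_le hθ hγ hδ hW hθW hγW hδW)
  have h813 : W ^ 8 ≤ W ^ 13 := pow_le_pow_right₀ hW (by norm_num)
  refine ⟨hM.trans ?_, hN.trans ?_, ?_, μ, hexec, fun r hr => ?_, fun l => ?_, ?_⟩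
  · push_cast
    linarith [hpow 13]
  · push_cast
    linarith [hpow 13]
  · exact hgood.trans (B.boundedKM_toOuterMeasure_le f _ _ _ _)
  · calc (r.2 : ℝ) ≤ ((1000 * (n + 1) ^ 2 * (⌊BayesNet.callBudget n θ⌋₊ + 1) *
          ((⌊BayesNet.searchBudget n θ δ⌋₊ + 1) + (⌊BayesNet.coeffBudget θ γ δ⌋₊ + 1)) : ℕ) : ℝ) :=
          Nat.cast_le.2 (hsteps r hr)
      _ = 1000 * ((n : ℝ) + 1) ^ 2 * ((⌊BayesNet.callBudget n θ⌋₊ + 1 : ℕ) : ℝ) *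
          (((⌊BayesNet.searchBudget n θ δ⌋₊ + 1 : ℕ) : ℝ) +
            ((⌊BayesNet.coeffBudget θ γ δ⌋₊ + 1 : ℕ) : ℝ)) := by push_cast; ring
      _ ≤ 1000 * W ^ 2 * ((9 + 1) * W ^ 3) * ((288 + 1) * W ^ 8 + (8 + 1) * W ^ 8) := by
          gcongr
      _ ≤ _ := by
          push_cast
          linarith [hpow 13, show 1000 * W ^ 2 * ((9 + 1) * W ^ 3) *
            ((288 + 1) * W ^ 8 + (8 + 1) * W ^ 8) = 2980000 * W ^ 13 by ring]
  · refine (hout {some l}).trans_le ?_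
    rw [PMF.toOuterMeasure_apply_singleton]
    exact B.boundedKM_le_extendedKM f _ _ l
  · exact hgood.trans_eq (hout _).symm
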